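/- Let $l>0$, $k\ge 3$, $d_1,d_2\in C^1(\mathbb R^2,(0,\infty))$ and $f,g\in C^{1,k}(\mathbb R^2\times\mathbb R^4,\mathbb R)$ ($C^1$ in $\mu$, $C^k$ in the state variables) with $f(\mu,0)=g(\mu,0)=0$ for all $\mu\in\mathbb R^2$. Consider on $(0,l\pi)$, with Neumann boundary conditions, the system $$u_t-d_1(\mu)u_{xx}=f(\mu,u(t),v(t),u(t-1),v(t-1)),\qquad v_t-d_2(\mu)v_{xx}=g(\mu,u(t),v(t),u(t-1),v(t-1)).$$ Let $A(\mu)$ and $B(\mu)$ be the real $2\times 2$ Jacobian matrices at $0$ of $(f,g)(\mu,\cdot)$ with respect to $(u(t),v(t))$ and $(u(t-1),v(t-1))$, let $D(\mu)=\mathrm{diag}(d_1(\mu),d_2(\mu))$, and let $\beta_n(x)=\cos(\tfrac nl x)/\|\cos(\tfrac nl\cdot)\|_{L^2(0,l\pi)}$. A number $\lambda\in\mathbb C$ is a characteristic value of mode $n\in\{0,1,2,\dots\}$ if $\det[\lambda I+\tfrac{n^2}{l^2}D(\mu)-A(\mu)-B(\mu)e^{-\lambda}]=0$; it is simple if it is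 a simple root of this equation and not a characteristic value of any other mode. Let $X_{\mathbb C}=\{(u,v)\in H^2((0,l\pi),\mathbb C)^2: u_x=v_x=0 \text{ at } x=0,l\pi\}$, let $\Delta$ be the Laplacian on $X_{\mathbb C}$ with domain $\{y\in X_{\mathbb C}:\Delta y\in X_{\mathbb C}\}$, and let $\mathcal{BC}$ be the space of functions $[-1,0]\to X_{\mathbb C}$ that are continuous on $[-1,0)$ and have a limit at $0^-$. On $\{\varphi\in C^1([-1,0],X_{\mathbb C}):\varphi(0)\in\mathrm{dom}\,\Delta\}$ put $$\mathcal A_\mu\varphi=\dot\varphi+X_0\,[D(\mu)\Delta\varphi(0)+A(\mu)\varphi(0)+B(\mu)\varphi(-1)-\dot\varphi(0)]\in\mathcal{BC},$$ where $X_0(\theta)=0$ for $\theta<0$ and $X_0(0)=I$. Let $\mathcal{BC}^*$ be the space of (row vector) functions $[0,1]\to X_{\mathbb C}$ that are continuous on $(0,1]$ with a limit at $0^+$, and define on $\{\psi\in C^1([0,1],X_{\mathbb C}):\psi(0)\in\mathrm{dom}\,\Delta\}$ the dual operator $$\mathcal A_\mu^*\psi=-\dot\psi+X_0\,[D(\mu)\Delta\psi(0)+\psi(0)A(\mu)+\psi(1)B(\mu)+\dot\psi(0)]\in\mathcal{BC}^*,$$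 where now $X_0(s)=0$ for $s>0$ and $X_0(0)=I$. The center subspaces $\mathcal P\subset\mathcal{BC}$ and $\mathcal P^*\subset\mathcal{BC}^*$ at $\mu_0$ are the sums of the generalized eigenspaces of $\mathcal A_{\mu_0}$ and of $\mathcal A_{\mu_0}^*$, respectively, over all $\lambda$ with $\mathrm{Re}\,\lambda=0$. For $n\ge 0$ let $$(\alpha,\beta)^{(n)}=\alpha(0)\beta(0)-\int_{-1}^0\int_0^\theta\alpha(\xi-\theta)\,d\eta_n(\theta)\,\beta(\xi)\,d\xi,\qquad \int_{-1}^0 d\eta_n(\theta)\varphi(\theta)=-\tfrac{n^2}{l^2}D(\mu_0)\varphi(0)+A(\mu_0)\varphi(0)+B(\mu_0)\varphi(-1),$$ for row vector functions $\alpha$ on $[0,1]$ and column vector functions $\beta$ on $[-1,0]$. Assume (H2) at $\mu_0\in\mathbb R^2$, with $\omega_0>0$ and an integer $n_2\ge 1$: on an open neighbourhood $O$ of $\mu_0$ there are real $C^1$ functions $\alpha,\omega,\gamma$ such that for $\mu\in O$ the numbers $\alpha(\mu)\pm i\omega(\mu)$ are simple characteristic values of mode $0$ and $\gamma(\mu)$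 is a simple characteristic value of mode $n_2$; $\alpha(\mu_0)=\gamma(\mu_0)=0$, $\omega(\mu_0)=\omega_0$, $\partial_{\mu_1}\alpha(\mu_0)\ne0$, $\partial_{\mu_2}\gamma(\mu_0)\neq0$; and at $\mu_0$ every characteristic value (of any mode) other than $\pm i\omega_0,0$ has non-zero real part. Then the system undergoes a Turing–Hopf bifurcation at $\mu=\mu_0$. That is, there are an open neighbourhood of $\mu_0$ and real $C^1$ functions $\alpha$, $\omega>0$, $\gamma$ on it such that, for $\mu$ in it, $\alpha(\mu)\pm i\omega(\mu)$ are eigenvalues of $\mathcal A_\mu$ of algebraic multiplicity one (one-dimensional generalized eigenspace) with spatially homogeneous eigenfunctions, and $\gamma(\mu)$ is an eigenvalue of $\mathcal A_\mu$ of algebraic multiplicity one with a spatially inhomogeneous eigenfunction; $\alpha(\mu_0)=\gamma(\mu_0)=0$, $\omega(\mu_0)=\omega_0$, $\partial_{\mu_1}\alpha(\mu_0)\neq0$, $\partial_{\mu_2}\gamma(\mu_0)\ne0$; and $\mathcal A_{\mu_0}$ has no eigenvalue on the imaginary axis other than $\pm i\omega_0$ and $0$. Moreover, write $A=A(\mu_0)$,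 $B=B(\mu_0)$, $d_1=d_1(\mu_0)$ and assume that the denominators $A_{12}+B_{12}e^{-i\omega_0}$, $A_{21}+B_{21}e^{-i\omega_0}$, $A_{12}+B_{12}$, $A_{21}+B_{21}$ are non-zero. Put $$k_1=\frac{i\omega_0-A_{11}-B_{11}e^{-i\omega_0}}{A_{12}+B_{12}e^{-i\omega_0}},\quad k_2=\frac{i\omega_0-A_{11}-B_{11}e^{-i\omega_0}}{A_{21}+B_{21}e^{-i\omega_0}},\quad k_3=\frac{d_1\frac{n_2^2}{l^2}-A_{11}-B_{11}}{A_{12}+B_{12}},\quad k_4=\frac{d_1\frac{n_2^2}{l^2}-A_{11}-B_{11}}{A_{21}+B_{21}},$$ $$T_1=\{k_1k_2+1+e^{-i\omega_0}[B_{11}+B_{21}k_2+k_1(B_{12}+B_{22}k_2)]\}^{-1},\qquad T_2=\{[B_{12}+B_{22}k_4+k_4]k_3+[B_{11}+B_{21}k_4+1]\}^{-1},$$ $$\phi_1(\theta)=e^{i\omega_0\theta}(1,k_1)^{\mathrm T},\quad \phi_2(\theta)=(1,k_3)^{\mathrm T},\quad \psi_1(s)=e^{-i\omega_0s}T_1(1,k_2),\quad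 \psi_2(s)=T_2(1,k_4).$$ Then $$\mathcal P=\mathrm{span}\{\phi_1\beta_0,\bar\phi_1\beta_0,\phi_2\beta_{n_2}\},\qquad \mathcal P^*=\mathrm{span}\{\psi_1\beta_0,\bar\psi_1\beta_0,\psi_2\beta_{n_2}\};$$ $\phi_1\beta_0$ and $\phi_2\beta_{n_2}$ are eigenfunctions of $\mathcal A_{\mu_0}$, and $\psi_1\beta_0$ and $\psi_2\beta_{n_2}$ are eigenfunctions of $\mathcal A^*_{\mu_0}$, for the eigenvalues $i\omega_0$ and $0$, respectively; and $(\psi_1,\phi_1)^{(0)}=1$, $(\psi_1,\bar\phi_1)^{(0)}=0$, $(\psi_2,\phi_2)^{(n_2)}=1$. -/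

import Mathlib

open Set Filter Topology MeasureTheory

noncomputable section

namespace TuringHopf

/-! ### Function spaces on the interval `(0, lπ)` -/

/-- Complex `L²(0, lπ)`. -/
abbrev L2 (l : ℝ) : Type := Lp ℂ 2 (volume.restrict (Ioo (0 : ℝ) (l * Real.pi)))

/-- Triples of `L²` functions with the Hilbert sum norm; a triple `(u, u_x, u_xx)` of a function
and its weak derivatives carries in this way the `H²` norm of `u`. -/
abbrev Jets (l : ℝ) : Type := PiLp 2 (fun _ : Fin 3 => L2 l)

/-- `p` is the weak derivative of `u` on `(0, lπ)`. -/
def IsWeakDeriv (l : ℝ) (u p : L2 l) : Prop :=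
  ∀ η : ℝ → ℝ, ContDiff ℝ ((⊤ : ℕ∞) : WithTop ℕ∞) η → HasCompactSupport η → tsupport η ⊆ Ioo 0 (l * Real.pi) →
    ∫ x in Ioo (0 : ℝ) (l * Real.pi), ((deriv η x : ℝ) : ℂ) * u x =
      -∫ x in Ioo (0 : ℝ) (l * Real.pi), ((η x : ℝ) : ℂ) * p x

/-- The continuous representative of `p` on `[0, lπ]` exists and vanishes at both end points. -/
def VanishesAtEnds (l : ℝ) (p : L2 l) : Prop :=
  ∃ P : ℝ → ℂ, ContinuousOn P (Icc 0 (l * Real.pi)) ∧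
    p =ᵐ[volume.restrict (Ioo (0 : ℝ) (l * Real.pi))] P ∧ P 0 = 0 ∧ P (l * Real.pi) = 0

theorem integrable_test {l : ℝ} {η : ℝ → ℝ} (h : Continuous η) (hc : HasCompactSupport η)
    (u : L2 l) :
    Integrable (fun x => ((η x : ℝ) : ℂ) * u x)
      (volume.restrict (Ioo (0 : ℝ) (l * Real.pi))) := by
  have hu : Integrable u (volume.restrict (Ioo (0 : ℝ) (l * Real.pi))) :=
    (Lp.memLp u).integrable (by norm_num)
  obtain ⟨C, hC⟩ := hc.exists_bound_of_continuous h
  refine hu.bdd_mul (c := C) (Complex.continuous_ofReal.comp h).aestronglyMeasurable ?_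
  exact ae_of_all _ fun x => by simpa using hC x

theorem IsWeakDeriv.add {l : ℝ} {u p v q : L2 l} (h1 : IsWeakDeriv l u p)
    (h2 : IsWeakDeriv l v q) : IsWeakDeriv l (u + v) (p + q) := by
  intro η hη hc hs
  have hd : Continuous (deriv η) := hη.continuous_deriv (by simp)
  have e : ∀ (ζ : ℝ → ℝ), Continuous ζ → HasCompactSupport ζ → ∀ a b : L2 l,
      ∫ x in Ioo (0 : ℝ) (l * Real.pi), ((ζ x : ℝ) : ℂ) * (a + b : L2 l) x =
      (∫ x in Ioo (0 : ℝ) (l * Real.pi), ((ζ x : ℝ) : ℂ) * a x) +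
      ∫ x in Ioo (0 : ℝ) (l * Real.pi), ((ζ x : ℝ) : ℂ) * b x := by
    intro ζ hz hzc a b
    rw [← integral_add (integrable_test hz hzc a) (integrable_test hz hzc b)]
    refine integral_congr_ae ?_
    filter_upwards [Lp.coeFn_add a b] with x hx
    rw [hx, Pi.add_apply, mul_add]
  rw [e _ hd hc.deriv, e _ hη.continuous hc, h1 η hη hc hs, h2 η hη hc hs, neg_add]

theorem IsWeakDeriv.smul {l : ℝ} {u p : L2 l} (c : ℂ) (h1 : IsWeakDeriv l u p) :
    IsWeakDeriv l (c • u) (c • p) := by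
  intro η hη hc hs
  have e : ∀ (ζ : ℝ → ℝ) (a : L2 l),
      ∫ x in Ioo (0 : ℝ) (l * Real.pi), ((ζ x : ℝ) : ℂ) * (c • a : L2 l) x =
      c * ∫ x in Ioo (0 : ℝ) (l * Real.pi), ((ζ x : ℝ) : ℂ) * a x := by
    intro ζ a
    rw [← integral_const_mul]
    refine integral_congr_ae ?_
    filter_upwards [Lp.coeFn_smul c a] with x hx
    rw [hx, Pi.smul_apply, smul_eq_mul]; ring
  rw [e, e, h1 η hη hc hs, mul_neg]

theorem IsWeakDeriv.zero (l : ℝ) : IsWeakDeriv l 0 0 := by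
  intro η hη hc hs
  have e : ∀ (ζ : ℝ → ℝ),
      ∫ x in Ioo (0 : ℝ) (l * Real.pi), ((ζ x : ℝ) : ℂ) * (0 : L2 l) x = 0 := by
    intro ζ
    rw [← integral_zero ℝ ℂ (μ := volume.restrict (Ioo (0 : ℝ) (l * Real.pi)))]
    refine integral_congr_ae ?_
    filter_upwards [Lp.coeFn_zero ℂ 2 (volume.restrict (Ioo (0 : ℝ) (l * Real.pi)))] with x hx
    rw [hx]; simp
  rw [e, e, neg_zero]

/-- `H²(0, lπ)` (complex valued) with the Neumann condition `u_x = 0` at `x = 0, lπ`.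
The element with components `0, 1, 2` is the function `u` with `u_x` and `u_xx`. -/
def H2N (l : ℝ) : Submodule ℂ (Jets l) where
  carrier := {y | IsWeakDeriv l (y 0) (y 1) ∧ IsWeakDeriv l (y 1) (y 2) ∧ VanishesAtEnds l (y 1)}
  zero_mem' := by
    refine ⟨IsWeakDeriv.zero l, IsWeakDeriv.zero l, 0, continuousOn_const, ?_, rfl, rfl⟩
    exact Lp.coeFn_zero ℂ 2 (volume.restrict (Ioo (0 : ℝ) (l * Real.pi)))
  add_mem' := by
    rintro y z ⟨h1, h2, P, hP, hPe, hP0, hP1⟩ ⟨k1, k2, Q, hQ, hQe, hQ0, hQ1⟩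
    refine ⟨h1.add k1, h2.add k2, P + Q, hP.add hQ, ?_, by simp [hP0, hQ0], by simp [hP1, hQ1]⟩
    exact (Lp.coeFn_add (y 1) (z 1)).trans (hPe.add hQe)
  smul_mem' := by
    rintro c y ⟨h1, h2, P, hP, hPe, hP0, hP1⟩
    refine ⟨h1.smul c, h2.smul c, c • P, hP.const_smul c, ?_, by simp [hP0], by simp [hP1]⟩
    exact (Lp.coeFn_smul c (y 1)).trans (hPe.const_smul c)

/-- The phase space `X_ℂ` of pairs `(u, v)`. -/
abbrev X (l : ℝ) : Type := PiLp 2 (fun _ : Fin 2 => H2N l)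

/-- `z = Δ y`, for `y` in the domain `{y ∈ X_ℂ : Δ y ∈ X_ℂ}` of the Neumann Laplacian on `X_ℂ`. -/
def IsLaplacian {l : ℝ} (y z : X l) : Prop :=
  ∀ i, (z i : Jets l) 0 = (y i : Jets l) 2

/-- The weak `x`-derivative of both components vanishes. -/
def IsSpatiallyHomogeneous {l : ℝ} (y : X l) : Prop :=
  ∀ i, (y i : Jets l) 1 = 0

/-- A `2 × 2` matrix acting on the pair `(u, v)`. -/
def matAct {l : ℝ} (M : Matrix (Fin 2) (Fin 2) ℂ) : X l →ₗ[ℂ] X l where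
  toFun y := WithLp.toLp 2 fun i => ∑ j, M i j • y j
  map_add' y z := by ext i : 1; simp [smul_add, Finset.sum_add_distrib]
  map_smul' c y := by ext i : 1; simp [smul_smul, mul_comm]

/-! ### The eigenfunctions `β_n` -/

/-- The normalising factor `1 / ‖cos (n x / l)‖` in `L²(0, lπ)`. -/
def betaCoeff (l : ℝ) (n : ℕ) : ℝ :=
  if n = 0 then √(1 / (l * Real.pi)) else √(2 / (l * Real.pi))

/-- `β_n(x)`. -/
def beta (l : ℝ) (n : ℕ) (x : ℝ) : ℝ := betaCoeff l n * Real.cos (n / l * x)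

/-- First derivative of `β_n`. -/
def betaD (l : ℝ) (n : ℕ) (x : ℝ) : ℝ := -(betaCoeff l n * (n / l) * Real.sin (n / l * x))

/-- Second derivative of `β_n`. -/
def betaDD (l : ℝ) (n : ℕ) (x : ℝ) : ℝ := -(betaCoeff l n * (n / l) ^ 2 * Real.cos (n / l * x))

theorem hasDerivAt_beta (l : ℝ) (n : ℕ) (x : ℝ) : HasDerivAt (beta l n) (betaD l n x) x := by
  have hlin : HasDerivAt (fun x : ℝ => (n / l * x : ℝ)) (n / l) x := by
    simpa using (hasDerivAt_id x).const_mul ((n : ℝ) / l)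
  exact (hlin.cos.const_mul (betaCoeff l n)).congr_deriv (by unfold betaD; ring)

theorem hasDerivAt_betaD (l : ℝ) (n : ℕ) (x : ℝ) : HasDerivAt (betaD l n) (betaDD l n x) x := by
  have hlin : HasDerivAt (fun x : ℝ => (n / l * x : ℝ)) (n / l) x := by
    simpa using (hasDerivAt_id x).const_mul ((n : ℝ) / l)
  exact (hlin.sin.const_mul (betaCoeff l n * (n / l))).neg.congr_deriv (by unfold betaDD; ring)

/-- A continuous real function as an element of `L²(0, lπ)`. -/
def contL2 (l : ℝ) (f : C(ℝ, ℝ)) : L2 l :=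
  MemLp.toLp (fun x => ((f x : ℝ) : ℂ)) <| by
    have hc : Continuous fun x => ((f x : ℝ) : ℂ) := Complex.continuous_ofReal.comp f.continuous
    obtain ⟨C, hC⟩ := (isCompact_Icc (a := (0 : ℝ)) (b := l * Real.pi)).exists_bound_of_continuousOn
      hc.continuousOn
    refine MemLp.of_bound hc.aestronglyMeasurable C ?_
    filter_upwards [ae_restrict_mem measurableSet_Ioo] with x hx
    exact hC x (Ioo_subset_Icc_self hx)

theorem contL2_ae (l : ℝ) (f : C(ℝ, ℝ)) :
    contL2 l f =ᵐ[volume.restrict (Ioo (0 : ℝ) (l * Real.pi))] fun x => ((f x : ℝ) : ℂ) :=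
  MemLp.coeFn_toLp _

theorem isWeakDeriv_contL2 (l : ℝ) (f g : C(ℝ, ℝ)) (h : ∀ x, HasDerivAt f (g x) x) :
    IsWeakDeriv l (contL2 l f) (contL2 l g) := by
  intro η hη hc hs
  have e : ∀ (ζ : ℝ → ℝ) (a : C(ℝ, ℝ)), tsupport ζ ⊆ Ioo 0 (l * Real.pi) →
      ∫ x in Ioo (0 : ℝ) (l * Real.pi), ((ζ x : ℝ) : ℂ) * (contL2 l a) x =
      ((∫ x, ζ x * a x : ℝ) : ℂ) := by
    intro ζ a hz
    rw [← setIntegral_eq_integral_of_forall_compl_eq_zero (s := Ioo (0 : ℝ) (l * Real.pi))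
      (f := fun x => ζ x * a x) (fun x hx => by
        rw [image_eq_zero_of_notMem_tsupport (fun hx' => hx (hz hx')), zero_mul]),
      ← integral_complex_ofReal]
    refine integral_congr_ae ?_
    filter_upwards [contL2_ae l a] with x hx
    rw [hx]; push_cast; rfl
  have hd : Continuous (deriv η) := hη.continuous_deriv (by simp)
  rw [e _ _ ((tsupport_deriv_subset (𝕜 := ℝ)).trans hs), e _ _ hs, ← Complex.ofReal_neg]
  congr 1
  have := integral_mul_deriv_eq_deriv_mul_of_integrable (u := η) (v := f) (u' := deriv η) (v' := g)
    (fun x _ => (hη.differentiable (by simp) x).hasDerivAt) (fun x _ => h x)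
    ((hη.continuous.mul g.continuous).integrable_of_hasCompactSupport hc.mul_right)
    ((hd.mul f.continuous).integrable_of_hasCompactSupport hc.deriv.mul_right)
    ((hη.continuous.mul f.continuous).integrable_of_hasCompactSupport hc.mul_right)
  rw [this, neg_neg]

/-- `β_n` as an element of `H²(0, lπ)` with Neumann conditions. -/
def betaMode (l : ℝ) (n : ℕ) : H2N l :=
  ⟨WithLp.toLp 2 ![contL2 l ⟨beta l n, by unfold beta; fun_prop⟩,
      contL2 l ⟨betaD l n, by unfold betaD; fun_prop⟩,
      contL2 l ⟨betaDD l n, by unfold betaDD; fun_prop⟩], by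
    refine ⟨isWeakDeriv_contL2 l _ _ (hasDerivAt_beta l n),
      isWeakDeriv_contL2 l _ _ (hasDerivAt_betaD l n),
      fun x => ((betaD l n x : ℝ) : ℂ), ?_, contL2_ae l _, by simp [betaD], ?_⟩
    · exact (Complex.continuous_ofReal.comp (by unfold betaD; fun_prop)).continuousOn
    · rcases eq_or_ne l 0 with rfl | hl
      · simp [betaD]
      · have : (n : ℝ) / l * (l * Real.pi) = n * Real.pi := by field_simp
        simp [betaD, this]⟩

/-! ### The reaction-diffusion system with delay -/

/-- `h(μ, w)` is of class `C^{1,k}`: the `w`-derivatives up to order `k` exist, are jointly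
continuous and have jointly continuous first derivatives with respect to `μ`. -/
def IsC1k (k : ℕ) (h : (Fin 2 → ℝ) → (Fin 4 → ℝ) → ℝ) : Prop :=
  (∀ μ, ContDiff ℝ k (h μ)) ∧
  ∀ j ≤ k,
    (Continuous fun p : (Fin 2 → ℝ) × (Fin 4 → ℝ) => iteratedFDeriv ℝ j (h p.1) p.2) ∧
    (∀ w, Differentiable ℝ fun μ => iteratedFDeriv ℝ j (h μ) w) ∧
    (Continuous fun p : (Fin 2 → ℝ) × (Fin 4 → ℝ) =>
      fderiv ℝ (fun μ => iteratedFDeriv ℝ j (h μ) p.2) p.1)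

/-- The data of the system
`u_t - d₁(μ) u_xx = f(μ, u(t), v(t), u(t-1), v(t-1))`,
`v_t - d₂(μ) v_xx = g(μ, u(t), v(t), u(t-1), v(t-1))`
on `(0, lπ)` with Neumann boundary conditions. -/
structure RDSystem where
  l : ℝ
  l_pos : 0 < l
  d : Fin 2 → (Fin 2 → ℝ) → ℝ
  d_pos : ∀ i μ, 0 < d i μ
  d_smooth : ∀ i, ContDiff ℝ 1 (d i)
  k : ℕ
  three_le_k : 3 ≤ k
  f : (Fin 2 → ℝ) → (Fin 4 → ℝ) → ℝ
  g : (Fin 2 → ℝ) → (Fin 4 → ℝ) → ℝ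
  f_smooth : IsC1k k f
  g_smooth : IsC1k k g
  f_zero : ∀ μ, f μ 0 = 0
  g_zero : ∀ μ, g μ 0 = 0

/-- The partial derivative of `h(μ, ·)` at `0` in the `j`-th state variable; the variables are
`(u(t), v(t), u(t-1), v(t-1))`. -/
def partialAtZero (h : (Fin 2 → ℝ) → (Fin 4 → ℝ) → ℝ) (μ : Fin 2 → ℝ) (j : Fin 4) : ℝ :=
  fderiv ℝ (h μ) 0 (Pi.single j 1)

namespace RDSystem

variable (S : RDSystem) (μ : Fin 2 → ℝ)

/-- `A(μ)`, as a complex matrix. -/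
def A : Matrix (Fin 2) (Fin 2) ℂ :=
  !![(partialAtZero S.f μ 0 : ℂ), (partialAtZero S.f μ 1 : ℂ);
     (partialAtZero S.g μ 0 : ℂ), (partialAtZero S.g μ 1 : ℂ)]

/-- `B(μ)`, as a complex matrix. -/
def B : Matrix (Fin 2) (Fin 2) ℂ :=
  !![(partialAtZero S.f μ 2 : ℂ), (partialAtZero S.f μ 3 : ℂ);
     (partialAtZero S.g μ 2 : ℂ), (partialAtZero S.g μ 3 : ℂ)]

/-- `D(μ) = diag(d₁(μ), d₂(μ))`. -/
def D : Matrix (Fin 2) (Fin 2) ℂ := Matrix.diagonal fun i => (S.d i μ : ℂ)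

/-- The characteristic function
`det [z I + (n²/l²) D(μ) - A(μ) - B(μ) e^{-z}]` of mode `n`. -/
def charFun (n : ℕ) (z : ℂ) : ℂ :=
  (z • (1 : Matrix (Fin 2) (Fin 2) ℂ) + ((n : ℂ) ^ 2 / (S.l : ℂ) ^ 2) • S.D μ
    - S.A μ - Complex.exp (-z) • S.B μ).det

/-- `z` is a simple characteristic value, of mode `n`: it is a simple root of the characteristic
equation of mode `n` and is not a root of that of any other mode. -/
def IsSimpleCharValue (n : ℕ) (z : ℂ) : Prop :=
  S.charFun μ n z = 0 ∧ deriv (S.charFun μ n) z ≠ 0 ∧ ∀ m, m ≠ n → S.charFun μ m z ≠ 0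

/-- The spectral hypothesis `(H2)` at `μ₀`, with frequency `ω₀` and Turing mode `n₂ ≠ 0`. -/
def HypH2 (μ₀ : Fin 2 → ℝ) (ω₀ : ℝ) (n₂ : ℕ) : Prop :=
  n₂ ≠ 0 ∧ 0 < ω₀ ∧
  (∃ O : Set (Fin 2 → ℝ), IsOpen O ∧ μ₀ ∈ O ∧
    ∃ α ω γ : (Fin 2 → ℝ) → ℝ,
      ContDiffOn ℝ 1 α O ∧ ContDiffOn ℝ 1 ω O ∧ ContDiffOn ℝ 1 γ O ∧
      (∀ μ ∈ O, S.IsSimpleCharValue μ 0 (α μ + ω μ * Complex.I) ∧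
        S.IsSimpleCharValue μ 0 (α μ - ω μ * Complex.I) ∧
        S.IsSimpleCharValue μ n₂ (γ μ)) ∧
      α μ₀ = 0 ∧ ω μ₀ = ω₀ ∧ fderiv ℝ α μ₀ (Pi.single 0 1) ≠ 0 ∧
      γ μ₀ = 0 ∧ fderiv ℝ γ μ₀ (Pi.single 1 1) ≠ 0) ∧
  ∀ (n : ℕ) (z : ℂ), S.charFun μ₀ n z = 0 →
    z ≠ ω₀ * Complex.I → z ≠ -(ω₀ * Complex.I) → z ≠ 0 → z.re ≠ 0

end RDSystem

/-! ### The phase space `BC` and the operators `A` and `A*` -/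

/-- Functions on `I` with values in `E` that are continuous off the point `c` and have a limit
at `c`. -/
def BCSpace (I : Set ℝ) (c : I) (E : Type) [NormedAddCommGroup E] [NormedSpace ℂ E] :
    Submodule ℂ (I → E) where
  carrier := {ψ | ContinuousOn ψ {c}ᶜ ∧ ∃ x, Tendsto ψ (𝓝[≠] c) (𝓝 x)}
  zero_mem' := ⟨continuousOn_const, 0, tendsto_const_nhds⟩
  add_mem' := by
    rintro φ ψ ⟨h1, x, hx⟩ ⟨h2, y, hy⟩
    exact ⟨h1.add h2, x + y, hx.add hy⟩
  smul_mem' := by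
    rintro a ψ ⟨h1, x, hx⟩
    exact ⟨h1.const_smul a, a • x, hx.const_smul a⟩

/-- The end point `0` of `[-1, 0]`. -/
def zeroL : Icc (-1 : ℝ) 0 := ⟨0, by norm_num⟩

/-- The end point `-1` of `[-1, 0]`. -/
def negOneL : Icc (-1 : ℝ) 0 := ⟨-1, by norm_num⟩

/-- The end point `0` of `[0, 1]`. -/
def zeroR : Icc (0 : ℝ) 1 := ⟨0, by norm_num⟩

/-- The end point `1` of `[0, 1]`. -/
def oneR : Icc (0 : ℝ) 1 := ⟨1, by norm_num⟩

/-- The space `BC` of functions on `[-1, 0]`, continuous on `[-1, 0)` with a limit at `0⁻`. -/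
abbrev BC (l : ℝ) : Type := BCSpace (Icc (-1 : ℝ) 0) zeroL (X l)

/-- The dual space `BC*` of functions on `[0, 1]`, continuous on `(0, 1]` with a limit at `0⁺`. -/
abbrev BCdual (l : ℝ) : Type := BCSpace (Icc (0 : ℝ) 1) zeroR (X l)

/-- `ψ` is the derivative of `φ` on `[a, b]` (one-sided at the end points). -/
def IsDerivOn {E : Type} [NormedAddCommGroup E] [NormedSpace ℂ E] {a b : ℝ} (hab : a ≤ b)
    (φ ψ : Icc a b → E) : Prop :=
  ∀ θ : Icc a b, HasDerivWithinAt (IccExtend hab φ) (ψ θ) (Icc a b) (θ : ℝ)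

theorem IsDerivOn.add {E : Type} [NormedAddCommGroup E] [NormedSpace ℂ E] {a b : ℝ}
    {hab : a ≤ b} {φ ψ φ' ψ' : Icc a b → E} (h : IsDerivOn hab φ ψ) (h' : IsDerivOn hab φ' ψ') :
    IsDerivOn hab (φ + φ') (ψ + ψ') := fun θ => (h θ).add (h' θ)

theorem IsDerivOn.smul {E : Type} [NormedAddCommGroup E] [NormedSpace ℂ E] {a b : ℝ}
    {hab : a ≤ b} {φ ψ : Icc a b → E} (c : ℂ) (h : IsDerivOn hab φ ψ) :
    IsDerivOn hab (c • φ) (c • ψ) := fun θ => (h θ).const_smul c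

theorem IsDerivOn.zero {E : Type} [NormedAddCommGroup E] [NormedSpace ℂ E] {a b : ℝ}
    (hab : a ≤ b) : IsDerivOn hab (0 : Icc a b → E) 0 :=
  fun θ => hasDerivWithinAt_const (θ : ℝ) (Icc a b) (0 : E)

theorem IsLaplacian.add {l : ℝ} {y z y' z' : X l} (h : IsLaplacian y z) (h' : IsLaplacian y' z') :
    IsLaplacian (y + y') (z + z') := fun i => by simp [h i, h' i]

theorem IsLaplacian.smul {l : ℝ} {y z : X l} (c : ℂ) (h : IsLaplacian y z) :
    IsLaplacian (c • y) (c • z) := fun i => by simp [h i]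

theorem IsLaplacian.zero {l : ℝ} : IsLaplacian (0 : X l) 0 := fun i => by simp

namespace RDSystem

variable (S : RDSystem) (μ : Fin 2 → ℝ)

/-- The graph of the operator
`φ ↦ φ̇ + X₀ [D(μ) Δ φ(0) + L(μ) φ - φ̇(0)]` in `BC`, with `L(μ) φ = A(μ) φ(0) + B(μ) φ(-1)`,
on the domain of all `φ ∈ C¹([-1, 0], X_ℂ)` with `φ(0) ∈ dom Δ`. -/
def generator : Submodule ℂ (BC S.l × BC S.l) where
  carrier := {p | ∃ φ' : Icc (-1 : ℝ) 0 → X S.l, ∃ z : X S.l,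
    Continuous φ' ∧ IsDerivOn (by norm_num) p.1.1 φ' ∧ IsLaplacian (p.1.1 zeroL) z ∧
    ∀ θ, p.2.1 θ = φ' θ + if θ = zeroL then
      matAct (S.D μ) z + (matAct (S.A μ) (p.1.1 zeroL) + matAct (S.B μ) (p.1.1 negOneL))
        - φ' zeroL else 0}
  zero_mem' := ⟨0, 0, continuous_const, IsDerivOn.zero _, IsLaplacian.zero, fun θ => by simp⟩
  add_mem' := by
    rintro p q ⟨φ, z, h1, h2, h3, h4⟩ ⟨φ', z', h1', h2', h3', h4'⟩
    refine ⟨φ + φ', z + z', h1.add h1', h2.add h2', h3.add h3', fun θ => ?_⟩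
    have e : (p + q).2.1 θ = p.2.1 θ + q.2.1 θ := rfl
    rw [e, h4, h4']
    split_ifs <;> simp only [Prod.fst_add, Submodule.coe_add, Pi.add_apply, map_add] <;> abel
  smul_mem' := by
    rintro c p ⟨φ, z, h1, h2, h3, h4⟩
    refine ⟨c • φ, c • z, h1.const_smul c, h2.smul c, h3.smul c, fun θ => ?_⟩
    have e : (c • p).2.1 θ = c • p.2.1 θ := rfl
    rw [e, h4]
    split_ifs <;>
      simp only [Prod.smul_fst, Submodule.coe_smul, Pi.smul_apply, map_smul, smul_add, smul_sub,
        smul_zero]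

/-- The graph of the dual operator
`ψ ↦ -ψ̇ + X₀ [D(μ) Δ ψ(0) + ψ(0) A(μ) + ψ(1) B(μ) + ψ̇(0)]` in `BC*`, where `ψ` is a row vector,
on the domain of all `ψ ∈ C¹([0, 1], X_ℂ)` with `ψ(0) ∈ dom Δ`. -/
def dualGenerator : Submodule ℂ (BCdual S.l × BCdual S.l) where
  carrier := {p | ∃ ψ' : Icc (0 : ℝ) 1 → X S.l, ∃ z : X S.l,
    Continuous ψ' ∧ IsDerivOn (by norm_num) p.1.1 ψ' ∧ IsLaplacian (p.1.1 zeroR) z ∧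
    ∀ s, p.2.1 s = -ψ' s + if s = zeroR then
      matAct (S.D μ) z + (matAct (S.A μ).transpose (p.1.1 zeroR)
        + matAct (S.B μ).transpose (p.1.1 oneR)) + ψ' zeroR else 0}
  zero_mem' := ⟨0, 0, continuous_const, IsDerivOn.zero _, IsLaplacian.zero, fun θ => by simp⟩
  add_mem' := by
    rintro p q ⟨φ, z, h1, h2, h3, h4⟩ ⟨φ', z', h1', h2', h3', h4'⟩
    refine ⟨φ + φ', z + z', h1.add h1', h2.add h2', h3.add h3', fun θ => ?_⟩
    have e : (p + q).2.1 θ = p.2.1 θ + q.2.1 θ := rfl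
    rw [e, h4, h4']
    split_ifs <;> simp only [Prod.fst_add, Submodule.coe_add, Pi.add_apply, map_add] <;> abel
  smul_mem' := by
    rintro c p ⟨φ, z, h1, h2, h3, h4⟩
    refine ⟨c • φ, c • z, h1.const_smul c, h2.smul c, h3.smul c, fun θ => ?_⟩
    have e : (c • p).2.1 θ = c • p.2.1 θ := rfl
    rw [e, h4]
    split_ifs <;>
      simp only [Prod.smul_fst, Submodule.coe_smul, Pi.smul_apply, map_smul, smul_add, smul_neg,
        smul_zero]

end RDSystem

/-! ### Root subspaces and the center subspace of an operator given by its graph -/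

section Spectral

variable {E : Type} [AddCommGroup E] [Module ℂ E]

/-- The kernel of `(T - z)^k`, for the operator `T` with graph `Γ`. -/
def rootKer (Γ : Submodule ℂ (E × E)) (z : ℂ) : ℕ → Submodule ℂ E
  | 0 => ⊥
  | k + 1 =>
    { carrier := {φ | ∃ χ, (φ, χ) ∈ Γ ∧ χ - z • φ ∈ rootKer Γ z k}
      zero_mem' := ⟨0, Γ.zero_mem, by simp⟩
      add_mem' := by
        rintro φ ψ ⟨χ, h1, h2⟩ ⟨χ', h1', h2'⟩
        refine ⟨χ + χ', Γ.add_mem h1 h1', ?_⟩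
        have := (rootKer Γ z k).add_mem h2 h2'
        rwa [show χ + χ' - z • (φ + ψ) = χ - z • φ + (χ' - z • ψ) by rw [smul_add]; abel]
      smul_mem' := by
        rintro c φ ⟨χ, h1, h2⟩
        refine ⟨c • χ, Γ.smul_mem c h1, ?_⟩
        have := (rootKer Γ z k).smul_mem c h2
        rwa [smul_sub, smul_comm c z φ] at this }

/-- The generalized eigenspace of `z`. -/
def rootSpace (Γ : Submodule ℂ (E × E)) (z : ℂ) : Submodule ℂ E := ⨆ k, rootKer Γ z k

/-- The sum of the generalized eigenspaces of all `z` on the imaginary axis. -/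
def centerSpace (Γ : Submodule ℂ (E × E)) : Submodule ℂ E :=
  ⨆ (z : ℂ) (_ : z.re = 0), rootSpace Γ z

/-- `z` is an eigenvalue. -/
def IsEigenvalue (Γ : Submodule ℂ (E × E)) (z : ℂ) : Prop :=
  ∃ φ, φ ≠ 0 ∧ (φ, z • φ) ∈ Γ

/-- `z` is an eigenvalue of algebraic multiplicity one. -/
def IsSimpleEigenvalue (Γ : Submodule ℂ (E × E)) (z : ℂ) : Prop :=
  Module.finrank ℂ (rootSpace Γ z) = 1

end Spectral

namespace RDSystem

variable (S : RDSystem)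

/-- The system undergoes a Turing-Hopf bifurcation at `μ₀`, with critical frequency `ω₀`:
near `μ₀` the generator of the linearization at the trivial equilibrium has a pair of
simple complex conjugate eigenvalues with spatially homogeneous eigenfunctions (Hopf) and a simple
real eigenvalue with a spatially inhomogeneous eigenfunction (Turing), which depend in a `C¹` way
on `μ`, reach the imaginary axis at `μ₀`, at `± i ω₀` and at `0`, and cross it with non-zero speed
in `μ₁` and in `μ₂`, respectively, while the generator at `μ₀` has no further eigenvalue on the
imaginary axis. -/
def UndergoesTuringHopf (μ₀ : Fin 2 → ℝ) (ω₀ : ℝ) : Prop :=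
  0 < ω₀ ∧
  (∃ O : Set (Fin 2 → ℝ), IsOpen O ∧ μ₀ ∈ O ∧
    ∃ α ω γ : (Fin 2 → ℝ) → ℝ,
      ContDiffOn ℝ 1 α O ∧ ContDiffOn ℝ 1 ω O ∧ ContDiffOn ℝ 1 γ O ∧
      (∀ μ ∈ O, 0 < ω μ ∧
        (∀ z : ℂ, z = α μ + ω μ * Complex.I ∨ z = α μ - ω μ * Complex.I →
          IsSimpleEigenvalue (S.generator μ) z ∧
          ∀ φ ∈ rootSpace (S.generator μ) z, ∀ θ, IsSpatiallyHomogeneous (φ.1 θ)) ∧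
        IsSimpleEigenvalue (S.generator μ) (γ μ) ∧
        ∀ φ ∈ rootSpace (S.generator μ) (γ μ),
          (∀ θ, IsSpatiallyHomogeneous (φ.1 θ)) → φ = 0) ∧
      α μ₀ = 0 ∧ ω μ₀ = ω₀ ∧ fderiv ℝ α μ₀ (Pi.single 0 1) ≠ 0 ∧
      γ μ₀ = 0 ∧ fderiv ℝ γ μ₀ (Pi.single 1 1) ≠ 0) ∧
  ∀ z : ℂ, IsEigenvalue (S.generator μ₀) z → z.re = 0 →
    z = ω₀ * Complex.I ∨ z = -(ω₀ * Complex.I) ∨ z = 0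

end RDSystem

/-! ### The functions `φ β_n` and the adjoint bilinear form -/

/-- The function `θ ↦ v(θ) β_n`. -/
def withMode (I : Set ℝ) (c : I) (l : ℝ) (v : C(ℝ, Fin 2 → ℂ)) (n : ℕ) :
    BCSpace I c (X l) :=
  ⟨fun θ => WithLp.toLp 2 fun i => v θ i • betaMode l n, by
    have h : Continuous fun θ : I =>
        (WithLp.toLp 2 fun i => v θ i • betaMode l n : X l) := by fun_prop
    exact ⟨h.continuousOn, _, h.continuousAt.tendsto.mono_left nhdsWithin_le_nhds⟩⟩

/-- `θ ↦ e^{i w θ} c`. -/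
def expVec (w : ℝ) (c : Fin 2 → ℂ) : C(ℝ, Fin 2 → ℂ) :=
  ⟨fun θ => Complex.exp (Complex.I * w * θ) • c, by fun_prop⟩

/-- The componentwise complex conjugate. -/
def conjVec (v : C(ℝ, Fin 2 → ℂ)) : C(ℝ, Fin 2 → ℂ) :=
  ⟨fun θ i => (starRingEnd ℂ) (v θ i), by fun_prop⟩

namespace RDSystem

variable (S : RDSystem) (μ : Fin 2 → ℝ)

/-- `∑_{i,j} ∫_{-1}^0 G_{ij}(θ) dη_n(θ)_{ij}`, where `η_n` represents
`φ ↦ -(n²/l²) D(μ) φ(0) + A(μ) φ(0) + B(μ) φ(-1)`, that is,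
`dη_n = (A(μ) - (n²/l²) D(μ)) δ_0 + B(μ) δ_{-1}`. -/
def etaInt (n : ℕ) (G : Fin 2 → Fin 2 → ℝ → ℂ) : ℂ :=
  ∑ i, ∑ j, ((S.A μ - ((n : ℂ) ^ 2 / (S.l : ℂ) ^ 2) • S.D μ) i j * G i j 0
    + S.B μ i j * G i j (-1))

/-- The adjoint bilinear form
`(α, β)_n = α(0) β(0) - ∫_{-1}^0 ∫_0^θ α(ξ - θ) dη_n(θ) β(ξ) dξ`
of a row vector function `α` on `[0, 1]` and a column vector function `β` on `[-1, 0]`. -/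
def adjForm (n : ℕ) (α β : ℝ → Fin 2 → ℂ) : ℂ :=
  ∑ i, α 0 i * β 0 i
    - S.etaInt μ n fun i j θ => ∫ ξ in (0 : ℝ)..θ, α (ξ - θ) i * β ξ j

variable (ω₀ : ℝ) (n₂ : ℕ)

/-- `e^{-i ω₀}`. -/
def expNeg (ω₀ : ℝ) : ℂ := Complex.exp (-(Complex.I * ω₀))

/-- The constant `k₁`. -/
def k1 : ℂ := (Complex.I * ω₀ - S.A μ 0 0 - S.B μ 0 0 * expNeg ω₀) /
  (S.A μ 0 1 + S.B μ 0 1 * expNeg ω₀)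

/-- The constant `k₂`. -/
def k2 : ℂ := (Complex.I * ω₀ - S.A μ 0 0 - S.B μ 0 0 * expNeg ω₀) /
  (S.A μ 1 0 + S.B μ 1 0 * expNeg ω₀)

/-- The constant `k₃`. -/
def k3 : ℂ := (S.d 0 μ * ((n₂ : ℂ) ^ 2 / (S.l : ℂ) ^ 2) - S.A μ 0 0 - S.B μ 0 0) /
  (S.A μ 0 1 + S.B μ 0 1)

/-- The constant `k₄`. -/
def k4 : ℂ := (S.d 0 μ * ((n₂ : ℂ) ^ 2 / (S.l : ℂ) ^ 2) - S.A μ 0 0 - S.B μ 0 0) /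
  (S.A μ 1 0 + S.B μ 1 0)

/-- The constant `T₁`. -/
def T1 : ℂ := (S.k1 μ ω₀ * S.k2 μ ω₀ + 1 + expNeg ω₀ *
  (S.B μ 0 0 + S.B μ 1 0 * S.k2 μ ω₀ +
    S.k1 μ ω₀ * (S.B μ 0 1 + S.B μ 1 1 * S.k2 μ ω₀)))⁻¹

/-- The constant `T₂`. -/
def T2 : ℂ := ((S.B μ 0 1 + S.B μ 1 1 * S.k4 μ n₂ + S.k4 μ n₂) * S.k3 μ n₂ +
  (S.B μ 0 0 + S.B μ 1 0 * S.k4 μ n₂ + 1))⁻¹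

/-- `φ₁(θ) = e^{i ω₀ θ} (1, k₁)`. -/
def phi1 : C(ℝ, Fin 2 → ℂ) := expVec ω₀ ![1, S.k1 μ ω₀]

/-- `φ₂(θ) = (1, k₃)`. -/
def phi2 : C(ℝ, Fin 2 → ℂ) := ContinuousMap.const ℝ ![1, S.k3 μ n₂]

/-- `ψ₁(s) = e^{-i ω₀ s} T₁ (1, k₂)`. -/
def psi1 : C(ℝ, Fin 2 → ℂ) := expVec (-ω₀) (S.T1 μ ω₀ • ![1, S.k2 μ ω₀])

/-- `ψ₂(s) = T₂ (1, k₄)`. -/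
def psi2 : C(ℝ, Fin 2 → ℂ) := ContinuousMap.const ℝ (S.T2 μ n₂ • ![1, S.k4 μ n₂])

/-- The element `v β_n` of `BC`. -/
def inBC (v : C(ℝ, Fin 2 → ℂ)) (n : ℕ) : BC S.l := withMode (Icc (-1 : ℝ) 0) zeroL S.l v n

/-- The element `v β_n` of `BC*`. -/
def inBCdual (v : C(ℝ, Fin 2 → ℂ)) (n : ℕ) : BCdual S.l := withMode (Icc (0 : ℝ) 1) zeroR S.l v n

end RDSystem

end TuringHopf

end

/-!
The linear problem decouples over the cosine modes. For `y ∈ H²` with Neumann conditions,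
integration by parts shows that the `n`-th cosine coefficient of `Δ y` is `-(n²/l²)` times that of
`y` (`cosCoeff_second_deriv`); boundary terms make sense for weak derivatives by the lemma of
du Bois-Reymond (`IsWeakDeriv.exists_continuousOn`). The cosines are complete
(`eq_zero_of_cosCoeff_eq_zero`), so an element of `BC` is determined by its mode coordinates, which
are functions `[-1, 0] → ℂ²`.

In the mode `n` the equation `(𝒜 - z) φ = e^{zθ} c` is a linear ordinary differential equation on
`[-1, 0)`; its solution is `e^{zθ} (b + θ c)`, and the condition at `θ = 0` becomes `M b = -M' c`,
where `M` is the characteristic matrix at `z` and `M' = I + e^{-z} B` is its derivative in `z`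
(`IsDelayGraph.modeCoord_eq`). Hence modes with `det M ≠ 0` do not contribute to the root
subspaces. If `det M = 0` and `(det M)' = tr (adj(M) M') ≠ 0` (Jacobi's formula,
`hasDerivAt_det_charMat`), then, as `adj(M) M'` acts on the kernel of `M` as the scalar
`tr (adj(M) M')`, no Jordan chain has length two (`eq_zero_of_jordan`), and the root subspace is
spanned by one function `e^{zθ} v β_n` with `M v = 0` (`IsDelayGraph.rootSpace_eq_span`). This turns
simple characteristic values into eigenvalues of algebraic multiplicity one and gives the center
subspace.

The dual operator is the reflection, under `s = -θ`, of a delay operator with transposed matrices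
(`isDelayGraph_reflect_dualGenerator`), so that the same results describe its center subspace.
Finally, for a characteristic value `z` with right and left null vectors `v` and `w` of `M`, the
adjoint form of `e^{-zs} w` and `e^{zθ} v` is `w M' v`, and `w M' v ≠ 0` because `adj(M)` is a
multiple of `v w` (`pairing_ne_zero`); on eigenfunctions of different eigenvalues the form vanishes
(`RDSystem.adjForm_expFun_eq_zero`).
-/

noncomputable section

namespace TuringHopf

/-! ### Weak derivatives on the interval -/

theorem integral_mul_primitive_real {L : ℝ} {q g g' : ℝ → ℝ}
    (hq : IntervalIntegrable q volume 0 L) (hg : ∀ x, HasDerivAt g (g' x) x) (hg' : Continuous g') :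
    ∫ x in (0 : ℝ)..L, g' x * ∫ t in (0 : ℝ)..x, q t =
      g L * (∫ t in (0 : ℝ)..L, q t) - ∫ x in (0 : ℝ)..L, g x * q x := by
  have hd : deriv g = g' := funext fun x => (hg x).deriv
  have hgc : ContDiff ℝ 1 g :=
    contDiff_one_iff_deriv.2 ⟨fun x => (hg x).differentiableAt, by rwa [hd]⟩
  have h := hgc.contDiffOn.absolutelyContinuousOnInterval.integral_mul_deriv_eq_deriv_mul
    (hq.absolutelyContinuousOnInterval_intervalIntegral (c := 0) (by simp))
  have e : ∫ x in (0 : ℝ)..L, g x * deriv (fun x => ∫ t in (0 : ℝ)..x, q t) x =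
      ∫ x in (0 : ℝ)..L, g x * q x := by
    refine intervalIntegral.integral_congr_ae ?_
    filter_upwards [hq.ae_hasDerivAt_integral] with x hx hx'
    rw [(hx (uIoc_subset_uIcc hx') 0 (by simp)).deriv]
  rw [e, hd, intervalIntegral.integral_same, mul_zero, sub_zero] at h
  rw [h]; ring

/-- Integration by parts against an indefinite integral of an integrable function. -/
theorem integral_mul_primitive {L : ℝ} {q : ℝ → ℂ} {g g' : ℝ → ℝ}
    (hq : IntervalIntegrable q volume 0 L) (hg : ∀ x, HasDerivAt g (g' x) x) (hg' : Continuous g') :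
    ∫ x in (0 : ℝ)..L, (g' x : ℂ) * ∫ t in (0 : ℝ)..x, q t =
      g L * (∫ t in (0 : ℝ)..L, q t) - ∫ x in (0 : ℝ)..L, (g x : ℂ) * q x := by
  have hgc : Continuous g := continuous_iff_continuousAt.2 fun x => (hg x).continuousAt
  have hsub : ∀ x ∈ uIcc 0 L, IntervalIntegrable q volume 0 x := fun x hx =>
    hq.mono_set (uIcc_subset_uIcc_left hx)
  have h1 : IntervalIntegrable (fun x => (g' x : ℂ) * ∫ t in (0 : ℝ)..x, q t) volume 0 L :=
    ((Complex.continuous_ofReal.comp hg').continuousOn.mul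
      (intervalIntegral.continuousOn_primitive_interval' hq (by simp))).intervalIntegrable
  have h2 : IntervalIntegrable (fun x => (g x : ℂ) * q x) volume 0 L :=
    hq.continuousOn_mul (Complex.continuous_ofReal.comp hgc).continuousOn
  -- Real and imaginary part are treated separately.
  have key : ∀ T : ℂ →L[ℝ] ℝ, (∀ (r : ℝ) (z : ℂ), T (r * z) = r * T z) →
      T (∫ x in (0 : ℝ)..L, (g' x : ℂ) * ∫ t in (0 : ℝ)..x, q t) =
      T (g L * (∫ t in (0 : ℝ)..L, q t) - ∫ x in (0 : ℝ)..L, (g x : ℂ) * q x) := by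
    intro T hT
    have hTq : IntervalIntegrable (fun x => T (q x)) volume 0 L :=
      ⟨T.integrable_comp hq.1, T.integrable_comp hq.2⟩
    rw [map_sub, hT, ← T.intervalIntegral_comp_comm h1, ← T.intervalIntegral_comp_comm h2,
      ← T.intervalIntegral_comp_comm hq]
    simp only [hT]
    rw [← integral_mul_primitive_real hTq hg hg']
    refine intervalIntegral.integral_congr fun x hx => ?_
    rw [T.intervalIntegral_comp_comm (hsub x hx)]
  exact Complex.ext (key Complex.reCLM (by simp)) (key Complex.imCLM (by simp))

/-- A smooth function with compact support in `(0, L)` and zero mean has a primitive of the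
same kind. -/
theorem exists_primitive_of_integral_eq_zero {L : ℝ} {ζ : ℝ → ℝ}
    (hζ : ContDiff ℝ ((⊤ : ℕ∞) : WithTop ℕ∞) ζ) {K : Set ℝ} (hK : IsCompact K)
    (hKL : K ⊆ Ioo 0 L) (hζK : ∀ x, x ∉ K → ζ x = 0) (h0 : ∫ x, ζ x = 0) :
    ∃ η : ℝ → ℝ, ContDiff ℝ ((⊤ : ℕ∞) : WithTop ℕ∞) η ∧ HasCompactSupport η ∧
      tsupport η ⊆ Ioo 0 L ∧ deriv η = ζ := by
  rcases K.eq_empty_or_nonempty with rfl | hne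
  · refine ⟨0, contDiff_const, HasCompactSupport.zero, by simp [tsupport], ?_⟩
    funext x
    simp [hζK x (by simp)]
  obtain ⟨a, haK, ha⟩ := hK.exists_isLeast hne
  obtain ⟨b, hbK, hb⟩ := hK.exists_isGreatest hne
  have hd : ∀ x, HasDerivAt (fun x => ∫ t in (0 : ℝ)..x, ζ t) (ζ x) x := fun x =>
    intervalIntegral.integral_hasDerivAt_right (hζ.continuous.intervalIntegrable _ _)
      (hζ.continuous.stronglyMeasurableAtFilter _ _) hζ.continuous.continuousAt
  have hsupp : ∀ x, x ∉ Icc a b → ∫ t in (0 : ℝ)..x, ζ t = 0 := by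
    intro x hx
    rcases lt_or_ge x a with hxa | hxa
    · rw [intervalIntegral.integral_congr (g := fun _ => 0), intervalIntegral.integral_zero]
      intro t ht
      refine hζK t fun htK => ?_
      have h1 := ha htK
      have h2 := ht.2
      have h3 : max 0 x < a := max_lt (hKL haK).1 hxa
      linarith
    · have hxb : b < x := by
        by_contra h
        exact hx ⟨hxa, not_lt.1 h⟩
      rw [intervalIntegral.integral_eq_integral_of_support_subset, h0]
      intro t ht
      have htK : t ∈ K := by
        by_contra h
        exact ht (hζK t h)
      exact ⟨(hKL htK).1, (hb htK).trans hxb.le⟩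
  have hts : tsupport (fun x => ∫ t in (0 : ℝ)..x, ζ t) ⊆ Icc a b :=
    closure_minimal (fun x hx => by
      by_contra h
      exact hx (hsupp x h)) isClosed_Icc
  refine ⟨fun x => ∫ t in (0 : ℝ)..x, ζ t, ?_, ?_, ?_, funext fun x => (hd x).deriv⟩
  · rw [contDiff_infty_iff_deriv]
    refine ⟨fun x => (hd x).differentiableAt, ?_⟩
    rwa [show deriv (fun x => ∫ t in (0 : ℝ)..x, ζ t) = ζ from funext fun x => (hd x).deriv]
  · exact isCompact_Icc.of_isClosed_subset (isClosed_tsupport _) hts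
  · exact hts.trans fun x hx => ⟨(hKL haK).1.trans_le hx.1, hx.2.trans_lt (hKL hbK).2⟩

theorem ae_eq_zero_of_test {L : ℝ} {w : ℝ → ℂ} (hw : IntegrableOn w (Ioo 0 L))
    (h : ∀ ζ : ℝ → ℝ, ContDiff ℝ ((⊤ : ℕ∞) : WithTop ℕ∞) ζ → HasCompactSupport ζ →
      tsupport ζ ⊆ Ioo 0 L → ∫ x in Ioo 0 L, (ζ x : ℂ) * w x = 0) :
    w =ᵐ[volume.restrict (Ioo 0 L)] 0 := by
  have := isOpen_Ioo.ae_eq_zero_of_integral_contDiff_smul_eq_zero (μ := volume)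
    hw.locallyIntegrableOn (fun ζ h1 h2 h3 => by
      rw [← h ζ h1 h2 h3]
      rw [setIntegral_eq_integral_of_forall_compl_eq_zero (fun x hx => by
        rw [image_eq_zero_of_notMem_tsupport (fun hx' => hx (h3 hx'))]; simp)]
      simp)
  exact (ae_restrict_iff' measurableSet_Ioo).2 this

/-- The lemma of du Bois-Reymond: a function with vanishing weak derivative is constant. -/
theorem ae_const_of_weakDeriv_zero {L : ℝ} (hL : 0 < L) {w : ℝ → ℂ}
    (hw : IntegrableOn w (Ioo 0 L))
    (h : ∀ η : ℝ → ℝ, ContDiff ℝ ((⊤ : ℕ∞) : WithTop ℕ∞) η → HasCompactSupport η →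
      tsupport η ⊆ Ioo 0 L → ∫ x in Ioo 0 L, ((deriv η x : ℝ) : ℂ) * w x = 0) :
    ∃ C : ℂ, w =ᵐ[volume.restrict (Ioo 0 L)] fun _ => C := by
  -- The constant is the mean of `w` against a fixed bump `χ` of mass one: a test function `ζ` minus
  -- `(∫ ζ) χ` has zero mean, hence is the derivative of a test function.
  let b : ContDiffBump (L / 2) := ⟨L / 8, L / 4, by positivity, by linarith⟩
  set χ : ℝ → ℝ := b.normed volume with hχ
  have hχs : ContDiff ℝ ((⊤ : ℕ∞) : WithTop ℕ∞) χ := b.contDiff_normed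
  have hχc : HasCompactSupport χ := b.hasCompactSupport_normed
  have hχL : tsupport χ ⊆ Ioo 0 L := by
    rw [hχ, b.tsupport_normed_eq, Real.closedBall_eq_Icc]
    intro x hx
    have : b.rOut = L / 4 := rfl
    rw [this] at hx
    exact ⟨by linarith [hx.1], by linarith [hx.2]⟩
  have hχ1 : ∫ x, χ x = 1 := b.integral_normed
  have hint : ∀ ζ : ℝ → ℝ, Continuous ζ → HasCompactSupport ζ →
      IntegrableOn (fun x => (ζ x : ℂ) * w x) (Ioo 0 L) := fun ζ hc hcs => by
    obtain ⟨C, hC⟩ := hcs.exists_bound_of_continuous hc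
    refine hw.bdd_mul (c := C) (Complex.continuous_ofReal.comp hc).aestronglyMeasurable ?_
    exact ae_of_all _ fun x => by simpa using hC x
  refine ⟨∫ x in Ioo 0 L, (χ x : ℂ) * w x, ?_⟩
  set C := ∫ x in Ioo 0 L, (χ x : ℂ) * w x with hC
  have hz : (fun x => w x - C) =ᵐ[volume.restrict (Ioo 0 L)] 0 := by
    refine ae_eq_zero_of_test (hw.sub (integrableOn_const (by simp))) ?_
    intro ζ hζ hζc hζL
    set m := ∫ x, ζ x with hm
    obtain ⟨η, h1, h2, h3, h4⟩ := exists_primitive_of_integral_eq_zero (L := L)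
      (ζ := fun x => ζ x - m * χ x) (hζ.sub (contDiff_const.mul hχs))
      (hζc.isCompact.union hχc.isCompact) (union_subset hζL hχL) (fun x hx => by
        rw [image_eq_zero_of_notMem_tsupport fun hx' => hx (Or.inl hx'),
          image_eq_zero_of_notMem_tsupport fun hx' => hx (Or.inr hx')]; simp)
      (by
        rw [integral_sub (hζ.continuous.integrable_of_hasCompactSupport hζc)
          ((hχs.continuous.integrable_of_hasCompactSupport hχc).const_mul m),
          integral_const_mul, hχ1, ← hm]; ring)
    have h5 := h η h1 h2 h3
    rw [h4] at h5
    have e1 : ∫ x in Ioo 0 L, ((ζ x - m * χ x : ℝ) : ℂ) * w x =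
        (∫ x in Ioo 0 L, (ζ x : ℂ) * w x) - m * C := by
      rw [hC, ← integral_const_mul, ← integral_sub (hint ζ hζ.continuous hζc)
        ((hint χ hχs.continuous hχc).const_mul _)]
      refine integral_congr_ae (ae_of_all _ fun x => ?_)
      simp only; push_cast; ring
    have e2 : ∫ x in Ioo 0 L, (ζ x : ℂ) * C = m * C := by
      rw [integral_mul_const, hm, ← integral_complex_ofReal]
      congr 1
      exact setIntegral_eq_integral_of_forall_compl_eq_zero fun x hx => by
        rw [image_eq_zero_of_notMem_tsupport fun hx' => hx (hζL hx'), Complex.ofReal_zero]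
    have hζi : IntegrableOn (fun x => (ζ x : ℂ) * C) (Ioo 0 L) :=
      (((hζ.continuous.integrable_of_hasCompactSupport hζc).ofReal).mul_const C).integrableOn
    simp only [mul_sub]
    rw [integral_sub (hint ζ hζ.continuous hζc) hζi, e2, ← e1, h5]
  filter_upwards [hz] with x hx
  exact sub_eq_zero.1 hx

theorem L2.intervalIntegrable {l : ℝ} (hl : 0 < l) (u : L2 l) :
    IntervalIntegrable u volume 0 (l * Real.pi) := by
  have hu : IntegrableOn u (Ioo (0 : ℝ) (l * Real.pi)) :=
    (Lp.memLp u).integrable (by norm_num)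
  rwa [intervalIntegrable_iff_integrableOn_Ioo_of_le (by positivity)]

theorem setIntegral_eq_interval {l : ℝ} (hl : 0 < l) (f : ℝ → ℂ) :
    ∫ x in Ioo (0 : ℝ) (l * Real.pi), f x = ∫ x in (0 : ℝ)..(l * Real.pi), f x := by
  rw [intervalIntegral.integral_of_le (by positivity), integral_Ioc_eq_integral_Ioo]

/-- A function with a weak derivative has a continuous representative, for which integration
by parts holds with boundary terms. -/
theorem IsWeakDeriv.exists_continuousOn {l : ℝ} (hl : 0 < l) {u p : L2 l}
    (h : IsWeakDeriv l u p) :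
    ∃ U : ℝ → ℂ, ContinuousOn U (Icc 0 (l * Real.pi)) ∧
      u =ᵐ[volume.restrict (Ioo (0 : ℝ) (l * Real.pi))] U ∧
      ∀ g g' : ℝ → ℝ, (∀ x, HasDerivAt g (g' x) x) → Continuous g' →
        ∫ x in Ioo (0 : ℝ) (l * Real.pi), (g' x : ℂ) * u x =
          g (l * Real.pi) * U (l * Real.pi) - g 0 * U 0 -
            ∫ x in Ioo (0 : ℝ) (l * Real.pi), (g x : ℂ) * p x := by
  set L := l * Real.pi with hL
  have hLpos : 0 < L := by positivity
  have hp : IntervalIntegrable p volume 0 L := L2.intervalIntegrable hl p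
  have hcont : ContinuousOn (fun x => ∫ t in (0 : ℝ)..x, p t) (Icc 0 L) := by
    have := intervalIntegral.continuousOn_primitive_interval' hp (left_mem_uIcc)
    rwa [uIcc_of_le hLpos.le] at this
  have hPint : IntegrableOn (fun x => ∫ t in (0 : ℝ)..x, p t) (Ioo 0 L) :=
    (hcont.integrableOn_Icc).mono_set Ioo_subset_Icc_self
  have hu : IntegrableOn u (Ioo 0 L) := (Lp.memLp u).integrable (by norm_num)
  have hparts : ∀ g g' : ℝ → ℝ, (∀ x, HasDerivAt g (g' x) x) → Continuous g' →
      ∫ x in Ioo (0 : ℝ) L, (g' x : ℂ) * (∫ t in (0 : ℝ)..x, p t) =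
        g L * (∫ t in (0 : ℝ)..L, p t) - ∫ x in Ioo (0 : ℝ) L, (g x : ℂ) * p x := by
    intro g g' hg hg'
    rw [setIntegral_eq_interval hl, setIntegral_eq_interval hl]
    exact integral_mul_primitive hp hg hg'
  have hbd : ∀ g' : ℝ → ℝ, Continuous g' → ∀ f : ℝ → ℂ, IntegrableOn f (Ioo 0 L) →
      IntegrableOn (fun x => (g' x : ℂ) * f x) (Ioo 0 L) := by
    intro g' hg' f hf
    obtain ⟨C, hC⟩ := (isCompact_Icc (a := (0 : ℝ)) (b := L)).exists_bound_of_continuousOn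
      hg'.continuousOn
    refine hf.bdd_mul (c := C) (Complex.continuous_ofReal.comp hg').aestronglyMeasurable ?_
    filter_upwards [ae_restrict_mem measurableSet_Ioo] with x hx
    simpa using hC x (Ioo_subset_Icc_self hx)
  -- `u` and the primitive of `p` have the same weak derivative, hence differ by a constant.
  obtain ⟨C, hC⟩ := ae_const_of_weakDeriv_zero hLpos (hu.sub hPint) (fun η hη hc hs => by
    have hd : Continuous (deriv η) := hη.continuous_deriv (by simp)
    have hηL : η L = 0 := image_eq_zero_of_notMem_tsupport fun hx => lt_irrefl _ (hs hx).2
    have e1 := h η hη hc hs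
    have e2 := hparts η (deriv η) (fun x => (hη.differentiable (by simp) x).hasDerivAt) hd
    simp only [Pi.sub_apply, mul_sub]
    rw [integral_sub (hbd _ hd _ hu) (hbd _ hd _ hPint), e1, e2, hηL]
    simp [hL])
  have hae : u =ᵐ[volume.restrict (Ioo (0 : ℝ) L)] fun x => C + ∫ t in (0 : ℝ)..x, p t := by
    filter_upwards [hC] with x hx
    rw [← hx]; simp
  refine ⟨fun x => C + ∫ t in (0 : ℝ)..x, p t, continuousOn_const.add hcont, hae, ?_⟩
  intro g g' hg hg'
  have e1 : ∫ x in Ioo (0 : ℝ) L, (g' x : ℂ) * u x =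
      ∫ x in Ioo (0 : ℝ) L, ((g' x : ℂ) * C + (g' x : ℂ) * ∫ t in (0 : ℝ)..x, p t) := by
    refine integral_congr_ae ?_
    filter_upwards [hae] with x hx
    rw [hx]; ring
  have e2 : ∫ x in Ioo (0 : ℝ) L, (g' x : ℂ) * C = (g L - g 0) * C := by
    rw [setIntegral_eq_interval hl, intervalIntegral.integral_mul_const,
      intervalIntegral.integral_ofReal,
      intervalIntegral.integral_eq_sub_of_hasDerivAt (fun x _ => hg x)
        (hg'.intervalIntegrable _ _)]
    push_cast; ring
  rw [e1, integral_add (hbd _ hg' _ (integrableOn_const (by simp))) (hbd _ hg' _ hPint), e2,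
    hparts g g' hg hg']
  simp only [← hL, intervalIntegral.integral_same]
  ring

/-- The zero function has only the zero weak derivative. -/
theorem IsWeakDeriv.eq_zero {l : ℝ} {p : L2 l} (h : IsWeakDeriv l 0 p) : p = 0 := by
  have hp : IntegrableOn p (Ioo 0 (l * Real.pi)) := (Lp.memLp p).integrable (by norm_num)
  have := ae_eq_zero_of_test hp (fun ζ h1 h2 h3 => by
    have e := h ζ h1 h2 h3
    rw [eq_comm, neg_eq_iff_eq_neg] at e
    rw [e, neg_eq_zero, ← integral_zero ℝ ℂ (μ := volume.restrict (Ioo (0 : ℝ) (l * Real.pi)))]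
    refine integral_congr_ae ?_
    filter_upwards [Lp.coeFn_zero ℂ 2 (volume.restrict (Ioo (0 : ℝ) (l * Real.pi)))] with x hx
    rw [hx]; simp)
  exact (Lp.eq_zero_iff_ae_eq_zero).2 this

/-! ### Fourier cosine coefficients -/

/-- The function `cos (n x / l)`. -/
def cosFn (l : ℝ) (n : ℕ) : C(ℝ, ℝ) := ⟨fun x => Real.cos (n / l * x), by fun_prop⟩

/-- The (unnormalized) Fourier cosine coefficient `∫ cos (n x / l) u(x) dx`. -/
def cosCoeff (l : ℝ) (n : ℕ) : L2 l →L[ℂ] ℂ := innerSL ℂ (contL2 l (cosFn l n))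

theorem cosCoeff_apply (l : ℝ) (n : ℕ) (u : L2 l) :
    cosCoeff l n u =
      ∫ x in Ioo (0 : ℝ) (l * Real.pi), ((Real.cos (n / l * x) : ℝ) : ℂ) * u x := by
  rw [cosCoeff, innerSL_apply_apply, L2.inner_def]
  refine integral_congr_ae ?_
  filter_upwards [contL2_ae l (cosFn l n)] with x hx
  rw [hx, RCLike.inner_apply, Complex.conj_ofReal, mul_comm]
  rfl

theorem integrable_continuous_mul {l : ℝ} {f : ℝ → ℝ} (hf : Continuous f) (u : L2 l) :
    Integrable (fun x => (f x : ℂ) * u x) (volume.restrict (Ioo (0 : ℝ) (l * Real.pi))) := by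
  have hu : Integrable u (volume.restrict (Ioo (0 : ℝ) (l * Real.pi))) :=
    (Lp.memLp u).integrable (by norm_num)
  obtain ⟨C, hC⟩ := (isCompact_Icc (a := (0 : ℝ)) (b := l * Real.pi)).exists_bound_of_continuousOn
    hf.continuousOn
  refine hu.bdd_mul (c := C) (Complex.continuous_ofReal.comp hf).aestronglyMeasurable ?_
  filter_upwards [ae_restrict_mem measurableSet_Ioo] with x hx
  simpa using hC x (Ioo_subset_Icc_self hx)

/-- Products `cos (x / l) ^ k * cos (n x / l)` are linear combinations of the `cos (m x / l)`. -/
theorem integral_cos_pow_mul {l : ℝ} {u : L2 l} (h : ∀ n, cosCoeff l n u = 0) (k n : ℕ) :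
    ∫ x in Ioo (0 : ℝ) (l * Real.pi),
      ((Real.cos (1 / l * x) ^ k * Real.cos (n / l * x) : ℝ) : ℂ) * u x = 0 := by
  induction k generalizing n with
  | zero => simpa [cosCoeff_apply] using h n
  | succ k ih =>
    rcases n with _ | n
    · simpa [pow_succ] using ih 1
    · have e : ∀ x : ℝ, ((Real.cos (1 / l * x) ^ (k + 1) * Real.cos ((n + 1 : ℕ) / l * x) : ℝ) : ℂ)
          * u x = (1 / 2 : ℂ) *
          (((Real.cos (1 / l * x) ^ k * Real.cos ((n + 2 : ℕ) / l * x) : ℝ) : ℂ) * u x) +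
          (1 / 2 : ℂ) * (((Real.cos (1 / l * x) ^ k * Real.cos (n / l * x) : ℝ) : ℂ) * u x) := by
        intro x
        have e1 : Real.cos ((n + 2 : ℕ) / l * x) + Real.cos (n / l * x) =
            2 * Real.cos ((n + 1 : ℕ) / l * x) * Real.cos (1 / l * x) := by
          rw [Real.cos_add_cos]
          congr 3 <;> push_cast <;> ring
        rw [← mul_add, ← add_mul, ← Complex.ofReal_add, ← mul_add, e1]
        push_cast
        ring
      simp only [e]
      rw [integral_add ((integrable_continuous_mul (by fun_prop) u).const_mul _)
        ((integrable_continuous_mul (by fun_prop) u).const_mul _), integral_const_mul,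
        integral_const_mul, ih, ih]
      simp

theorem integral_polynomial_cos {l : ℝ} {u : L2 l} (h : ∀ n, cosCoeff l n u = 0)
    (p : Polynomial ℝ) :
    ∫ x in Ioo (0 : ℝ) (l * Real.pi), ((p.eval (Real.cos (1 / l * x)) : ℝ) : ℂ) * u x = 0 := by
  induction p using Polynomial.induction_on' with
  | add p q hp hq =>
    simp only [Polynomial.eval_add, Complex.ofReal_add, add_mul]
    rw [integral_add (integrable_continuous_mul (f := fun x => p.eval (Real.cos (1 / l * x)))
        (by fun_prop) u)
      (integrable_continuous_mul (f := fun x => q.eval (Real.cos (1 / l * x))) (by fun_prop) u),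
      hp, hq, add_zero]
  | monomial k a =>
    have := integral_cos_pow_mul h k 0
    simp only [Polynomial.eval_monomial, Complex.ofReal_mul, mul_assoc]
    rw [integral_const_mul]
    simp only [Nat.cast_zero, zero_div, zero_mul, Real.cos_zero, mul_one] at this
    rw [this, mul_zero]

/-- The functions `cos (n x / l)` are complete in `L²(0, lπ)`: the substitution `t = cos (x / l)`
turns uniform polynomial approximation on `[-1, 1]` into approximation by cosines. -/
theorem eq_zero_of_cosCoeff_eq_zero {l : ℝ} (hl : 0 < l) {u : L2 l}
    (h : ∀ n, cosCoeff l n u = 0) : u = 0 := by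
  have hu : IntegrableOn u (Ioo 0 (l * Real.pi)) := (Lp.memLp u).integrable (by norm_num)
  refine (Lp.eq_zero_iff_ae_eq_zero).2 (ae_eq_zero_of_test hu fun ζ hζ _ _ => ?_)
  set N := ∫ x in Ioo (0 : ℝ) (l * Real.pi), ‖u x‖ with hN
  have hN0 : 0 ≤ N := integral_nonneg fun _ => norm_nonneg _
  rw [← norm_le_zero_iff]
  refine le_of_forall_pos_le_add fun ε hε => ?_
  obtain ⟨p, hp⟩ := exists_polynomial_near_of_continuousOn (-1) 1
    (fun t => ζ (l * Real.arccos t))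
    (hζ.continuous.comp (continuous_const.mul Real.continuous_arccos)).continuousOn
    (ε / (N + 1)) (by positivity)
  have hpc : Continuous fun x => p.eval (Real.cos (1 / l * x)) := by fun_prop
  have e : ∫ x in Ioo (0 : ℝ) (l * Real.pi), (ζ x : ℂ) * u x =
      ∫ x in Ioo (0 : ℝ) (l * Real.pi),
        ((ζ x : ℂ) * u x - ((p.eval (Real.cos (1 / l * x)) : ℝ) : ℂ) * u x) := by
    rw [integral_sub (integrable_continuous_mul hζ.continuous u) (integrable_continuous_mul hpc u),
      integral_polynomial_cos h, sub_zero]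
  rw [e]
  have hle : ‖∫ x in Ioo (0 : ℝ) (l * Real.pi),
      ((ζ x : ℂ) * u x - ((p.eval (Real.cos (1 / l * x)) : ℝ) : ℂ) * u x)‖ ≤
      ∫ x in Ioo (0 : ℝ) (l * Real.pi), ε / (N + 1) * ‖u x‖ := by
    refine norm_integral_le_of_norm_le (hu.norm.const_mul _) ?_
    filter_upwards [ae_restrict_mem measurableSet_Ioo] with x hx
    have harc : l * Real.arccos (Real.cos (1 / l * x)) = x := by
      rw [Real.arccos_cos]
      · field_simp
      · have := hx.1
        positivity
      · rw [one_div, inv_mul_le_iff₀ hl]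
        exact hx.2.le
    have h1 := hp (Real.cos (1 / l * x)) ⟨Real.neg_one_le_cos _, Real.cos_le_one _⟩
    rw [harc] at h1
    rw [← sub_mul, norm_mul, ← Complex.ofReal_sub, Complex.norm_real, Real.norm_eq_abs,
      abs_sub_comm]
    gcongr
  refine hle.trans ?_
  rw [integral_const_mul, ← hN, zero_add, div_mul_eq_mul_div, div_le_iff₀ (by positivity)]
  nlinarith

/-- The Neumann Laplacian is diagonal in the cosine coefficients. -/
theorem cosCoeff_second_deriv {l : ℝ} (hl : 0 < l) (n : ℕ) (y : H2N l) :
    cosCoeff l n ((y : Jets l) 2) =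
      -((n : ℂ) ^ 2 / (l : ℂ) ^ 2) * cosCoeff l n ((y : Jets l) 0) := by
  obtain ⟨h1, h2, P, hP, hPe, hP0, hPL⟩ := y.2
  have hLpos : 0 < l * Real.pi := by positivity
  obtain ⟨U, -, -, hUi⟩ := h1.exists_continuousOn hl
  obtain ⟨V, hV, hVe, hVi⟩ := h2.exists_continuousOn hl
  -- The Neumann condition removes the boundary terms of `u_x`; those of `u` vanish because
  -- `sin (n x / l)` does at both ends.
  have hVP : EqOn V P (Icc 0 (l * Real.pi)) := by
    refine Measure.eqOn_Icc_of_ae_eq volume hLpos.ne ?_ hV hP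
    rw [← Measure.restrict_congr_set Ioo_ae_eq_Icc]
    exact hVe.symm.trans hPe
  have hlin : ∀ x : ℝ, HasDerivAt (fun x : ℝ => (n / l * x : ℝ)) (n / l) x := fun x => by
    simpa using (hasDerivAt_id x).const_mul ((n : ℝ) / l)
  have hnL : (n : ℝ) / l * (l * Real.pi) = n * Real.pi := by field_simp
  have e1 := hVi (fun x => Real.cos (n / l * x)) (fun x => -(n / l) * Real.sin (n / l * x))
    (fun x => (hlin x).cos.congr_deriv (by ring)) (by fun_prop)
  have e2 := hUi (fun x => Real.sin (n / l * x)) (fun x => (n / l) * Real.cos (n / l * x))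
    (fun x => (hlin x).sin.congr_deriv (by ring)) (by fun_prop)
  rw [hVP (left_mem_Icc.2 hLpos.le), hVP (right_mem_Icc.2 hLpos.le), hP0, hPL] at e1
  simp only [hnL, Real.sin_nat_mul_pi, mul_zero, Real.sin_zero] at e2
  simp only [Complex.ofReal_mul, mul_assoc, integral_const_mul, ← cosCoeff_apply] at e1 e2
  push_cast at e1 e2
  linear_combination e1 + (n / l : ℂ) * e2

/-- An element of `H²` is determined by its cosine coefficients. -/
theorem H2N.eq_zero_of_cosCoeff {l : ℝ} (hl : 0 < l) {y : H2N l}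
    (h : ∀ n, cosCoeff l n ((y : Jets l) 0) = 0) : y = 0 := by
  obtain ⟨h1, h2, -⟩ := y.2
  have y0 : (y : Jets l) 0 = 0 := eq_zero_of_cosCoeff_eq_zero hl h
  rw [y0] at h1
  have y1 := h1.eq_zero
  rw [y1] at h2
  have y2 := h2.eq_zero
  ext i : 2
  fin_cases i
  exacts [y0, y1, y2]

theorem betaMode_two (l : ℝ) (n : ℕ) :
    (betaMode l n : Jets l) 2 = (-((n : ℂ) ^ 2 / (l : ℂ) ^ 2)) • (betaMode l n : Jets l) 0 := by
  refine Lp.ext ?_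
  have a0 := contL2_ae l ⟨beta l n, by unfold beta; fun_prop⟩
  have a2 := contL2_ae l ⟨betaDD l n, by unfold betaDD; fun_prop⟩
  filter_upwards [a0, a2, Lp.coeFn_smul (-((n : ℂ) ^ 2 / (l : ℂ) ^ 2)) ((betaMode l n : Jets l) 0)]
    with x h0 h2 h3
  rw [h3, Pi.smul_apply]
  refine h2.trans ?_
  have h0' : ((betaMode l n : Jets l) 0) x = ((beta l n x : ℝ) : ℂ) := h0
  rw [h0']
  simp only [ContinuousMap.coe_mk, betaDD, beta, smul_eq_mul]
  push_cast
  ring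

/-- Different modes are orthogonal, being eigenfunctions of the Neumann Laplacian for different
eigenvalues. -/
theorem cosCoeff_betaMode_of_ne {l : ℝ} (hl : 0 < l) {m n : ℕ} (hmn : m ≠ n) :
    cosCoeff l m ((betaMode l n : Jets l) 0) = 0 := by
  have h := cosCoeff_second_deriv hl m (betaMode l n)
  rw [betaMode_two, map_smul, smul_eq_mul] at h
  have h' : ((m : ℂ) ^ 2 / (l : ℂ) ^ 2 - (n : ℂ) ^ 2 / (l : ℂ) ^ 2) *
      cosCoeff l m ((betaMode l n : Jets l) 0) = 0 := by linear_combination h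
  refine (mul_eq_zero.1 h').resolve_left ?_
  have hl' : (l : ℂ) ≠ 0 := by exact_mod_cast hl.ne'
  rw [← sub_div]
  refine div_ne_zero ?_ (pow_ne_zero _ hl')
  intro h0
  have : (m ^ 2 : ℕ) = n ^ 2 := by exact_mod_cast sub_eq_zero.1 h0
  exact hmn (Nat.pow_left_injective (n := 2) (by norm_num) this)

theorem cosCoeff_betaMode_self {l : ℝ} (hl : 0 < l) (n : ℕ) :
    cosCoeff l n ((betaMode l n : Jets l) 0) ≠ 0 := by
  have hL : 0 < l * Real.pi := by positivity
  have hb : 0 < betaCoeff l n := by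
    unfold betaCoeff
    split_ifs <;> positivity
  have e : cosCoeff l n ((betaMode l n : Jets l) 0) =
      ((∫ x in (0 : ℝ)..(l * Real.pi), betaCoeff l n * Real.cos (n / l * x) ^ 2 : ℝ) : ℂ) := by
    rw [cosCoeff_apply, ← intervalIntegral.integral_ofReal, ← setIntegral_eq_interval hl]
    refine integral_congr_ae ?_
    filter_upwards [contL2_ae l ⟨beta l n, by unfold beta; fun_prop⟩] with x h0
    have h0' : ((betaMode l n : Jets l) 0) x = ((beta l n x : ℝ) : ℂ) := h0
    rw [h0', beta]
    push_cast
    ring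
  rw [e, Complex.ofReal_ne_zero]
  refine (intervalIntegral.integral_pos hL (by fun_prop) (fun x _ => by positivity)
    ⟨0, left_mem_Icc.2 hL.le, ?_⟩).ne'
  simpa using hb

/-! ### Coordinates on the phase space -/

/-- A shortcut for instance search. -/
instance instNormedSpaceX (l : ℝ) : NormedSpace ℂ (X l) := PiLp.normedSpace 2 ℂ _

/-- The real structure that `IsDerivOn` refers to. -/
instance instNormedSpaceRealX (l : ℝ) : NormedSpace ℝ (X l) := NormedSpace.complexToReal

/-- The pair of `n`-th cosine coefficients of an element of the phase space. -/
def modeCoord (l : ℝ) (n : ℕ) : X l →L[ℂ] (Fin 2 → ℂ) :=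
  ContinuousLinearMap.pi fun i =>
    ((cosCoeff l n).comp (PiLp.proj 2 (fun _ : Fin 3 => L2 l) 0 : Jets l →L[ℂ] L2 l)).comp
      ((H2N l).subtypeL.comp (PiLp.proj 2 (fun _ : Fin 2 => H2N l) i : X l →L[ℂ] H2N l))

theorem modeCoord_apply {l : ℝ} (n : ℕ) (y : X l) (i : Fin 2) :
    modeCoord l n y i = cosCoeff l n ((y i : Jets l) 0) := rfl

theorem modeCoord_zero (l : ℝ) (n : ℕ) : modeCoord l n 0 = 0 := (modeCoord l n).map_zero

theorem modeCoord_add {l : ℝ} (n : ℕ) (y z : X l) :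
    modeCoord l n (y + z) = modeCoord l n y + modeCoord l n z := (modeCoord l n).map_add y z

theorem modeCoord_sub {l : ℝ} (n : ℕ) (y z : X l) :
    modeCoord l n (y - z) = modeCoord l n y - modeCoord l n z := (modeCoord l n).map_sub y z

theorem modeCoord_smul {l : ℝ} (n : ℕ) (a : ℂ) (y : X l) :
    modeCoord l n (a • y) = a • modeCoord l n y := (modeCoord l n).map_smul a y

theorem eq_zero_of_modeCoord {l : ℝ} (hl : 0 < l) {y : X l} (h : ∀ n, modeCoord l n y = 0) :
    y = 0 := by
  ext i : 1
  exact H2N.eq_zero_of_cosCoeff hl fun n => congrFun (h n) i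

theorem modeCoord_laplacian {l : ℝ} (hl : 0 < l) (n : ℕ) {y z : X l} (h : IsLaplacian y z) :
    modeCoord l n z = -((n : ℂ) ^ 2 / (l : ℂ) ^ 2) • modeCoord l n y := by
  funext i
  rw [Pi.smul_apply, modeCoord_apply, modeCoord_apply, h i, cosCoeff_second_deriv hl, smul_eq_mul]

theorem modeCoord_matAct {l : ℝ} (n : ℕ) (M : Matrix (Fin 2) (Fin 2) ℂ) (y : X l) :
    modeCoord l n (matAct M y) = M.mulVec (modeCoord l n y) := by
  funext i
  have e : (matAct M y) i = ∑ j, M i j • y j := rfl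
  rw [modeCoord_apply, e]
  simp [Matrix.mulVec, dotProduct, Fin.sum_univ_two, modeCoord_apply]

/-- The element `v β_n` of the phase space. -/
def vecMode (l : ℝ) (n : ℕ) (v : Fin 2 → ℂ) : X l := WithLp.toLp 2 fun i => v i • betaMode l n

theorem vecMode_add {l : ℝ} (n : ℕ) (v w : Fin 2 → ℂ) :
    vecMode l n (v + w) = vecMode l n v + vecMode l n w := by
  ext i : 1
  simp [vecMode, add_smul]

theorem vecMode_smul {l : ℝ} (n : ℕ) (a : ℂ) (v : Fin 2 → ℂ) :
    vecMode l n (a • v) = a • vecMode l n v := by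
  ext i : 1
  simp [vecMode, mul_smul]

theorem matAct_vecMode {l : ℝ} (n : ℕ) (M : Matrix (Fin 2) (Fin 2) ℂ) (v : Fin 2 → ℂ) :
    matAct M (vecMode l n v) = vecMode l n (M.mulVec v) := by
  ext i : 1
  have e : (matAct M (vecMode l n v)) i = ∑ j, M i j • (v j • betaMode l n) := rfl
  have e' : (vecMode l n (M.mulVec v)) i = (∑ j, M i j * v j) • betaMode l n := rfl
  rw [e, e', Finset.sum_smul]
  simp only [mul_smul]

theorem isLaplacian_vecMode (l : ℝ) (n : ℕ) (v : Fin 2 → ℂ) :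
    IsLaplacian (vecMode l n v) (-((n : ℂ) ^ 2 / (l : ℂ) ^ 2) • vecMode l n v) := by
  intro i
  have e : (vecMode l n v) i = v i • betaMode l n := rfl
  rw [PiLp.smul_apply, e]
  simp only [Submodule.coe_smul, PiLp.smul_apply, betaMode_two]
  rw [smul_comm]

theorem modeCoord_vecMode_of_ne {l : ℝ} (hl : 0 < l) {m n : ℕ} (h : m ≠ n) (v : Fin 2 → ℂ) :
    modeCoord l m (vecMode l n v) = 0 := by
  funext i
  have e : (vecMode l n v) i = v i • betaMode l n := rfl
  rw [modeCoord_apply, e, Submodule.coe_smul, PiLp.smul_apply, map_smul,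
    cosCoeff_betaMode_of_ne hl h, smul_zero, Pi.zero_apply]

theorem modeCoord_vecMode_self (l : ℝ) (n : ℕ) (v : Fin 2 → ℂ) :
    modeCoord l n (vecMode l n v) = cosCoeff l n ((betaMode l n : Jets l) 0) • v := by
  funext i
  have e : (vecMode l n v) i = v i • betaMode l n := rfl
  rw [modeCoord_apply, e, Submodule.coe_smul, PiLp.smul_apply, map_smul, Pi.smul_apply,
    smul_eq_mul, smul_eq_mul, mul_comm]

/-- The constant mode is spatially homogeneous. -/
theorem isSpatiallyHomogeneous_vecMode_zero (l : ℝ) (v : Fin 2 → ℂ) :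
    IsSpatiallyHomogeneous (vecMode l 0 v) := by
  intro i
  have e : (vecMode l 0 v) i = v i • betaMode l 0 := rfl
  have e1 : (betaMode l 0 : Jets l) 1 = 0 := by
    refine (Lp.eq_zero_iff_ae_eq_zero).2 ?_
    filter_upwards [contL2_ae l ⟨betaD l 0, by unfold betaD; fun_prop⟩] with x hx
    exact hx.trans (by simp [betaD])
  rw [e, Submodule.coe_smul, PiLp.smul_apply, e1, smul_zero]

/-- Spatially homogeneous states have no component in the modes `n ≠ 0`. -/
theorem IsSpatiallyHomogeneous.modeCoord_eq_zero {l : ℝ} (hl : 0 < l) {y : X l}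
    (h : IsSpatiallyHomogeneous y) {n : ℕ} (hn : n ≠ 0) : modeCoord l n y = 0 := by
  funext i
  obtain ⟨-, h2, -⟩ := (y i).2
  rw [h i] at h2
  have e := cosCoeff_second_deriv hl n (y i)
  rw [h2.eq_zero, map_zero] at e
  have hl' : (l : ℂ) ≠ 0 := by exact_mod_cast hl.ne'
  have hn' : (n : ℂ) ≠ 0 := by exact_mod_cast hn
  rw [modeCoord_apply, Pi.zero_apply]
  refine (mul_eq_zero.1 e.symm).resolve_left ?_
  exact neg_ne_zero.2 (div_ne_zero (pow_ne_zero _ hn') (pow_ne_zero _ hl'))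

/-! ### Two by two matrices -/

/-- For `M c = 0`, the matrix `adj(M) N` acts on `c` as the scalar `tr (adj(M) N)`. -/
theorem adjugate_mul_mulVec_of_ker {M N : Matrix (Fin 2) (Fin 2) ℂ} {c : Fin 2 → ℂ}
    (h : M.mulVec c = 0) :
    (M.adjugate * N).mulVec c = (M.adjugate * N).trace • c := by
  have h0 := congrFun h 0
  have h1 := congrFun h 1
  simp only [Matrix.mulVec, dotProduct, Fin.sum_univ_two, Pi.zero_apply] at h0 h1
  funext i
  fin_cases i <;>
    simp [Matrix.mulVec, dotProduct, Fin.sum_univ_two, Matrix.adjugate_fin_two, Matrix.mul_apply,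
      Matrix.trace, Matrix.vecMul]
  · linear_combination N 0 1 * h1 - N 1 1 * h0
  · linear_combination N 1 0 * h0 - N 0 0 * h1

/-- A solution of `M b = - N c` with `M c = 0` exists only for `c = 0` when
`tr (adj(M) N) ≠ 0`: Jordan chains have length one. -/
theorem eq_zero_of_jordan {M N : Matrix (Fin 2) (Fin 2) ℂ} (ht : (M.adjugate * N).trace ≠ 0)
    (hdet : M.det = 0) {b c : Fin 2 → ℂ} (hc : M.mulVec c = 0)
    (hb : M.mulVec b = -N.mulVec c) : c = 0 := by
  have h1 : M.adjugate.mulVec (M.mulVec b) = 0 := by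
    rw [Matrix.mulVec_mulVec, Matrix.adjugate_mul, hdet, zero_smul, Matrix.zero_mulVec]
  rw [hb, Matrix.mulVec_neg, neg_eq_zero, Matrix.mulVec_mulVec, adjugate_mul_mulVec_of_ker hc] at h1
  exact (smul_eq_zero.1 h1).resolve_left ht

/-- The kernel of a non-zero `2 × 2` matrix is at most one-dimensional. -/
theorem exists_smul_eq_of_ker {M : Matrix (Fin 2) (Fin 2) ℂ} (hM : M ≠ 0) {v b : Fin 2 → ℂ}
    (hv : v ≠ 0) (hMv : M.mulVec v = 0) (hMb : M.mulVec b = 0) : ∃ a : ℂ, b = a • v := by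
  have hdet : v 0 * b 1 - v 1 * b 0 = 0 := by
    by_contra hne
    refine hM ?_
    ext i j
    have e1 := congrFun hMv i
    have e2 := congrFun hMb i
    simp only [Matrix.mulVec, dotProduct, Fin.sum_univ_two, Pi.zero_apply] at e1 e2
    refine (mul_eq_zero.1 (?_ : (v 0 * b 1 - v 1 * b 0) * M i j = 0)).resolve_left hne
    fin_cases j
    · simp only [Fin.zero_eta]
      linear_combination b 1 * e1 - v 1 * e2
    · simp only [Fin.mk_one]
      linear_combination -b 0 * e1 + v 0 * e2
  by_cases h0 : v 0 = 0
  · have h1 : v 1 ≠ 0 := fun h1 => hv (by funext i; fin_cases i <;> simpa)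
    refine ⟨b 1 / v 1, ?_⟩
    funext i
    fin_cases i <;> simp <;> field_simp
    linear_combination -hdet
  · refine ⟨b 0 / v 0, ?_⟩
    funext i
    fin_cases i <;> simp <;> field_simp
    linear_combination hdet

/-! ### Delay operators and their root subspaces -/

/-- `Γ` is the graph of `φ ↦ φ̇ + X₀ [D Δ φ(0) + A φ(0) + B φ(-1) - φ̇(0)]` in `BC`. -/
def IsDelayGraph {l : ℝ} (D A B : Matrix (Fin 2) (Fin 2) ℂ) (Γ : Submodule ℂ (BC l × BC l)) :
    Prop :=
  ∀ p, p ∈ Γ ↔ ∃ φ' : Icc (-1 : ℝ) 0 → X l, ∃ z : X l,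
    Continuous φ' ∧ IsDerivOn (by norm_num) p.1.1 φ' ∧ IsLaplacian (p.1.1 zeroL) z ∧
    ∀ θ, p.2.1 θ = φ' θ + if θ = zeroL then
      matAct D z + (matAct A (p.1.1 zeroL) + matAct B (p.1.1 negOneL)) - φ' zeroL else 0

/-- The characteristic matrix `z I + (n²/l²) D - A - e^{-z} B` of mode `n`. -/
def charMat (l : ℝ) (D A B : Matrix (Fin 2) (Fin 2) ℂ) (n : ℕ) (z : ℂ) :
    Matrix (Fin 2) (Fin 2) ℂ :=
  z • (1 : Matrix (Fin 2) (Fin 2) ℂ) + ((n : ℂ) ^ 2 / (l : ℂ) ^ 2) • D - A - Complex.exp (-z) • B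

/-- `z` is a simple root of the characteristic equation of mode `n`, and not a root for any other
mode; the trace is the derivative of the determinant by Jacobi's formula. -/
structure IsSimpleMode (l : ℝ) (D A B : Matrix (Fin 2) (Fin 2) ℂ) (n : ℕ) (z : ℂ) : Prop where
  det_eq_zero : (charMat l D A B n z).det = 0
  trace_ne_zero : ((charMat l D A B n z).adjugate * (1 + Complex.exp (-z) • B)).trace ≠ 0
  det_ne_zero : ∀ m, m ≠ n → (charMat l D A B m z).det ≠ 0

/-- The function `θ ↦ e^{zθ} v`. -/
def expFun (z : ℂ) (v : Fin 2 → ℂ) : C(ℝ, Fin 2 → ℂ) :=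
  ⟨fun θ => Complex.exp (z * θ) • v, by fun_prop⟩

/-- The function `θ ↦ e^{zθ} v β_n` of `BC`. -/
def expMode (l : ℝ) (z : ℂ) (v : Fin 2 → ℂ) (n : ℕ) : BC l :=
  withMode (Icc (-1 : ℝ) 0) zeroL l (expFun z v) n

theorem expMode_apply (l : ℝ) (z : ℂ) (v : Fin 2 → ℂ) (n : ℕ) (θ : Icc (-1 : ℝ) 0) :
    (expMode l z v n).1 θ = Complex.exp (z * (θ : ℝ)) • vecMode l n v := by
  rw [← vecMode_smul]
  rfl

section DelayGraph

variable {l : ℝ} {D A B : Matrix (Fin 2) (Fin 2) ℂ} {Γ : Submodule ℂ (BC l × BC l)}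

/-- In each spatial mode, an exponential right-hand side of the resolvent equation is resonant:
the solution is a polynomial times the same exponential, and the condition at `θ = 0` is an
equation for the characteristic matrix. -/
theorem IsDelayGraph.modeCoord_eq (hΓ : IsDelayGraph D A B Γ) (hl : 0 < l) {φ χ : BC l}
    (h : (φ, χ) ∈ Γ) (n : ℕ) (z : ℂ) (c : Fin 2 → ℂ)
    (hc : ∀ θ, modeCoord l n ((χ - z • φ).1 θ) = Complex.exp (z * (θ : ℝ)) • c) :
    ∃ b : Fin 2 → ℂ,
      (∀ θ, modeCoord l n (φ.1 θ) = Complex.exp (z * (θ : ℝ)) • (b + ((θ : ℝ) : ℂ) • c)) ∧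
      (charMat l D A B n z).mulVec b = -(1 + Complex.exp (-z) • B).mulVec c := by
  obtain ⟨φ', w, hφ', hd, hw, hχ⟩ := (hΓ _).1 h
  dsimp only at hd hw hχ
  have hle : (-1 : ℝ) ≤ 0 := by norm_num
  have hcoord : ∀ θ, modeCoord l n (χ.1 θ) =
      z • modeCoord l n (φ.1 θ) + Complex.exp (z * (θ : ℝ)) • c := fun θ => by
    have e : (χ - z • φ).1 θ = χ.1 θ - z • φ.1 θ := rfl
    have := hc θ
    rw [e, modeCoord_sub, modeCoord_smul] at this
    rw [← this]; abel
  set f : ℝ → Fin 2 → ℂ := fun t => modeCoord l n (IccExtend hle φ.1 t) with hf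
  have hfθ : ∀ θ : Icc (-1 : ℝ) 0, f θ = modeCoord l n (φ.1 θ) := fun θ => by
    rw [hf]; simp only [IccExtend_val]
  have hfd : ∀ θ : Icc (-1 : ℝ) 0,
      HasDerivWithinAt f (modeCoord l n (φ' θ)) (Icc (-1) 0) (θ : ℝ) := fun θ =>
    ((modeCoord l n).restrictScalars ℝ).hasFDerivAt.comp_hasDerivWithinAt _ (hd θ)
  have hexp : ∀ t : ℝ,
      HasDerivAt (fun t : ℝ => Complex.exp (-z * t)) (Complex.exp (-z * t) * -z) t :=
    fun t => by
      have h1 : HasDerivAt (fun t : ℝ => -z * (t : ℂ)) (-z) t := by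
        simpa using (Complex.ofRealCLM.hasDerivAt (x := t)).const_mul (-z)
      exact h1.cexp
  set g : ℝ → Fin 2 → ℂ := fun t => Complex.exp (-z * t) • f t - (t : ℂ) • c with hg
  have hee : ∀ t : ℝ, Complex.exp (-z * t) * Complex.exp (z * t) = 1 := fun t => by
    rw [← Complex.exp_add]; simp
  have hgd : ∀ θ : Icc (-1 : ℝ) 0, HasDerivWithinAt g
      (Complex.exp (-z * (θ : ℝ)) • (modeCoord l n (φ' θ) - z • f θ) - c) (Icc (-1) 0) (θ : ℝ) := by
    intro θ
    have h1 := (hexp θ).hasDerivWithinAt (s := Icc (-1) 0) |>.smul (hfd θ)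
    have h2 : HasDerivWithinAt (fun t : ℝ => (t : ℂ) • c) c (Icc (-1) 0) (θ : ℝ) := by
      simpa using ((Complex.ofRealCLM.hasDerivAt (x := (θ : ℝ))).smul_const c).hasDerivWithinAt
        (s := Icc (-1) 0)
    refine (h1.sub h2).congr_deriv ?_
    rw [smul_sub, mul_neg, neg_smul, ← smul_assoc, smul_eq_mul]
    abel
  -- The differential equation is only available on `[-1, 0)`, as `χ` carries the condition at `0`
  -- instead; right derivatives there determine `g` on the closed interval.
  have hconst := constant_of_has_deriv_right_zero (f := g) (a := -1) (b := 0)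
    (fun t ht => (hgd ⟨t, ht⟩).continuousWithinAt) (fun t ht => by
      have ht' : t ∈ Icc (-1 : ℝ) 0 := Ico_subset_Icc_self ht
      have hne : (⟨t, ht'⟩ : Icc (-1 : ℝ) 0) ≠ zeroL := fun h => ht.2.ne (congrArg Subtype.val h)
      have h1 := hχ ⟨t, ht'⟩
      rw [if_neg hne, add_zero] at h1
      have h2 := hcoord ⟨t, ht'⟩
      rw [h1] at h2
      have h3 := hgd ⟨t, ht'⟩
      rw [h2, hfθ, add_sub_cancel_left, smul_smul, hee, one_smul, sub_self] at h3
      exact (h3.mono_of_mem_nhdsWithin (Icc_mem_nhdsGE_of_mem ht)))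
  have hform : ∀ θ : Icc (-1 : ℝ) 0, modeCoord l n (φ.1 θ) =
      Complex.exp (z * (θ : ℝ)) • (g (-1) + ((θ : ℝ) : ℂ) • c) := by
    intro θ
    rw [← hconst θ θ.2, hg]
    simp only
    rw [sub_add_cancel, smul_smul, mul_comm (Complex.exp _), hee, one_smul, hfθ]
  -- The condition at `θ = 0`.
  refine ⟨g (-1), hform, ?_⟩
  set b := g (-1)
  have h0 := hcoord zeroL
  have h1 := hχ zeroL
  rw [if_pos rfl, add_sub_cancel] at h1
  have f0 := hform zeroL
  have fm := hform negOneL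
  have v0 : ((zeroL : Icc (-1 : ℝ) 0) : ℝ) = 0 := rfl
  have vm : ((negOneL : Icc (-1 : ℝ) 0) : ℝ) = -1 := rfl
  rw [v0] at f0 h0
  rw [vm] at fm
  rw [h1, modeCoord_add, modeCoord_add, modeCoord_matAct, modeCoord_matAct, modeCoord_matAct,
    modeCoord_laplacian hl n hw, f0, fm] at h0
  simp only [Complex.ofReal_zero, mul_zero, Complex.exp_zero, zero_smul, add_zero, one_smul,
    Complex.ofReal_neg, Complex.ofReal_one, mul_neg, mul_one, neg_smul, ← sub_eq_add_neg,
    Matrix.mulVec_smul, Matrix.mulVec_neg, Matrix.mulVec_sub, smul_sub] at h0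
  rw [charMat, Matrix.sub_mulVec, Matrix.sub_mulVec, Matrix.add_mulVec, Matrix.add_mulVec,
    Matrix.smul_mulVec, Matrix.smul_mulVec, Matrix.smul_mulVec, Matrix.smul_mulVec,
    Matrix.one_mulVec, Matrix.one_mulVec]
  linear_combination (norm := module) -h0

/-- Root vectors have no component in the modes for which `z` is not a characteristic value. -/
theorem IsDelayGraph.modeCoord_rootKer_eq_zero (hΓ : IsDelayGraph D A B Γ) (hl : 0 < l) {n : ℕ}
    {z : ℂ} (hdet : (charMat l D A B n z).det ≠ 0) (k : ℕ) :
    ∀ φ ∈ rootKer Γ z k, ∀ θ, modeCoord l n (φ.1 θ) = 0 := by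
  induction k with
  | zero =>
    intro φ hφ θ
    rw [(Submodule.mem_bot ℂ).1 hφ]
    exact modeCoord_zero l n
  | succ k ih =>
    rintro φ ⟨χ, h, hk⟩ θ
    obtain ⟨b, h1, h2⟩ := hΓ.modeCoord_eq hl h n z 0 fun θ => by rw [ih _ hk, smul_zero]
    rw [Matrix.mulVec_zero, neg_zero] at h2
    rw [h1, Matrix.eq_zero_of_mulVec_eq_zero hdet h2, smul_zero, add_zero, smul_zero]

/-- In the mode of a simple characteristic value, root vectors of any order are eigenvectors. -/
theorem IsDelayGraph.exists_modeCoord_rootKer_eq (hΓ : IsDelayGraph D A B Γ) (hl : 0 < l) {n : ℕ}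
    {z : ℂ} (hs : IsSimpleMode l D A B n z) (k : ℕ) :
    ∀ φ ∈ rootKer Γ z k, ∃ b : Fin 2 → ℂ, (charMat l D A B n z).mulVec b = 0 ∧
      ∀ θ, modeCoord l n (φ.1 θ) = Complex.exp (z * (θ : ℝ)) • b := by
  induction k with
  | zero =>
    intro φ hφ
    rw [(Submodule.mem_bot ℂ).1 hφ]
    exact ⟨0, Matrix.mulVec_zero _, fun θ => by rw [smul_zero]; exact modeCoord_zero l n⟩
  | succ k ih =>
    rintro φ ⟨χ, h, hk⟩
    obtain ⟨c, hc, hcθ⟩ := ih _ hk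
    obtain ⟨b, h1, h2⟩ := hΓ.modeCoord_eq hl h n z c hcθ
    obtain rfl := eq_zero_of_jordan hs.trace_ne_zero hs.det_eq_zero hc h2
    rw [Matrix.mulVec_zero, neg_zero] at h2
    exact ⟨b, h2, fun θ => by rw [h1, smul_zero, add_zero]⟩

theorem IsDelayGraph.expMode_mem (hΓ : IsDelayGraph D A B Γ) {n : ℕ} {z : ℂ} {v : Fin 2 → ℂ}
    (hv : (charMat l D A B n z).mulVec v = 0) :
    (expMode l z v n, z • expMode l z v n) ∈ Γ := by
  refine (hΓ _).2 ⟨fun θ => z • (expMode l z v n).1 θ, -((n : ℂ) ^ 2 / (l : ℂ) ^ 2) • vecMode l n v,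
    ?_, ?_, ?_, ?_⟩
  · simp only [expMode_apply]
    fun_prop
  · intro θ
    have h1 : HasDerivAt (fun t : ℝ => Complex.exp (z * t) • vecMode l n v)
        ((Complex.exp (z * (θ : ℝ)) * z) • vecMode l n v) (θ : ℝ) := by
      have h2 : HasDerivAt (fun t : ℝ => z * (t : ℂ)) z (θ : ℝ) := by
        simpa using (Complex.ofRealCLM.hasDerivAt (x := (θ : ℝ))).const_mul z
      exact h2.cexp.smul_const (vecMode l n v)
    have e : ∀ t (ht : t ∈ Icc (-1 : ℝ) 0),
        IccExtend (by norm_num : (-1 : ℝ) ≤ 0) (expMode l z v n).1 t =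
        Complex.exp (z * t) • vecMode l n v := fun t ht => by
      rw [IccExtend_of_mem _ _ ht, expMode_apply]
    refine (h1.hasDerivWithinAt.congr e (e θ θ.2)).congr_deriv ?_
    simp only
    rw [expMode_apply, smul_smul, mul_comm z (Complex.exp _)]
  · dsimp only
    rw [expMode_apply]
    have v0 : ((zeroL : Icc (-1 : ℝ) 0) : ℝ) = 0 := rfl
    rw [v0, Complex.ofReal_zero, mul_zero, Complex.exp_zero, one_smul]
    exact isLaplacian_vecMode l n v
  · intro θ
    have e : (z • expMode l z v n).1 θ = z • (expMode l z v n).1 θ := rfl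
    dsimp only
    rw [e]
    split_ifs with hθ
    · subst hθ
      have v0 : ((zeroL : Icc (-1 : ℝ) 0) : ℝ) = 0 := rfl
      have vm : ((negOneL : Icc (-1 : ℝ) 0) : ℝ) = -1 := rfl
      rw [add_sub_cancel, expMode_apply, expMode_apply, v0, vm]
      simp only [Complex.ofReal_zero, mul_zero, Complex.exp_zero, one_smul, Complex.ofReal_neg,
        Complex.ofReal_one, mul_neg, mul_one]
      rw [map_smul, map_smul, matAct_vecMode, matAct_vecMode, matAct_vecMode, ← vecMode_smul,
        ← vecMode_smul, ← vecMode_smul, ← vecMode_add, ← vecMode_add]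
      congr 1
      rw [charMat, Matrix.sub_mulVec, Matrix.sub_mulVec, Matrix.add_mulVec,
        Matrix.smul_mulVec, Matrix.smul_mulVec, Matrix.smul_mulVec, Matrix.one_mulVec] at hv
      linear_combination (norm := module) hv
    · rw [add_zero]

theorem IsSimpleMode.charMat_ne_zero {n : ℕ} {z : ℂ} (hs : IsSimpleMode l D A B n z) :
    charMat l D A B n z ≠ 0 := fun h => hs.trace_ne_zero (by
  rw [h]
  simp [Matrix.trace])

theorem BC.ext_modeCoord (hl : 0 < l) {φ ψ : BC l}
    (h : ∀ n θ, modeCoord l n (φ.1 θ) = modeCoord l n (ψ.1 θ)) : φ = ψ := by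
  refine Subtype.ext (funext fun θ => sub_eq_zero.1 (eq_zero_of_modeCoord hl fun n => ?_))
  rw [modeCoord_sub, h, sub_self]

/-- The generalized eigenspace of a simple characteristic value is spanned by one eigenfunction. -/
theorem IsDelayGraph.rootSpace_eq_span (hΓ : IsDelayGraph D A B Γ) (hl : 0 < l) {n : ℕ}
    {z : ℂ} (hs : IsSimpleMode l D A B n z) {v : Fin 2 → ℂ} (hv : v ≠ 0)
    (hMv : (charMat l D A B n z).mulVec v = 0) :
    rootSpace Γ z = Submodule.span ℂ {expMode l z v n} := by
  refine le_antisymm (iSup_le fun k φ hφ => ?_) ?_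
  · obtain ⟨b, hb, hφb⟩ := hΓ.exists_modeCoord_rootKer_eq hl hs k φ hφ
    obtain ⟨a, rfl⟩ := exists_smul_eq_of_ker hs.charMat_ne_zero hv hMv hb
    have hκ := cosCoeff_betaMode_self hl n
    obtain ⟨κ, hκ'⟩ : ∃ κ, κ = cosCoeff l n ((betaMode l n : Jets l) 0) := ⟨_, rfl⟩
    rw [← hκ'] at hκ
    refine Submodule.mem_span_singleton.2 ⟨a / κ, BC.ext_modeCoord hl fun m θ => ?_⟩
    have e : ((a / κ) • expMode l z v n).1 θ = (a / κ) • (expMode l z v n).1 θ := rfl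
    rw [e, expMode_apply, modeCoord_smul, modeCoord_smul]
    rcases eq_or_ne m n with rfl | hm
    · rw [hφb, modeCoord_vecMode_self, ← hκ', smul_smul, smul_smul, smul_smul]
      congr 1
      field_simp
    · rw [modeCoord_vecMode_of_ne hl hm, smul_zero, smul_zero,
        hΓ.modeCoord_rootKer_eq_zero hl (hs.det_ne_zero m hm) k φ hφ]
  · rw [Submodule.span_singleton_le_iff_mem]
    refine Submodule.mem_iSup_of_mem 1 ⟨_, hΓ.expMode_mem hMv, ?_⟩
    rw [sub_self]
    exact Submodule.zero_mem _

theorem IsDelayGraph.rootSpace_eq_bot (hΓ : IsDelayGraph D A B Γ) (hl : 0 < l) {z : ℂ}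
    (h : ∀ n, (charMat l D A B n z).det ≠ 0) : rootSpace Γ z = ⊥ := by
  refine le_bot_iff.1 (iSup_le fun k φ hφ => (Submodule.mem_bot ℂ).2 ?_)
  refine BC.ext_modeCoord hl fun n θ => ?_
  rw [hΓ.modeCoord_rootKer_eq_zero hl (h n) k φ hφ]
  exact (modeCoord_zero l n).symm

theorem expMode_ne_zero (hl : 0 < l) (z : ℂ) {v : Fin 2 → ℂ} (hv : v ≠ 0) (n : ℕ) :
    expMode l z v n ≠ 0 := by
  intro h
  have h1 : modeCoord l n ((expMode l z v n).1 zeroL) = 0 := by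
    rw [h]
    exact modeCoord_zero l n
  rw [expMode_apply, modeCoord_smul, modeCoord_vecMode_self] at h1
  exact smul_ne_zero (Complex.exp_ne_zero _) (smul_ne_zero (cosCoeff_betaMode_self hl n) hv) h1

theorem IsDelayGraph.exists_rootSpace_eq_span (hΓ : IsDelayGraph D A B Γ) (hl : 0 < l) {n : ℕ}
    {z : ℂ} (hs : IsSimpleMode l D A B n z) :
    ∃ v : Fin 2 → ℂ, v ≠ 0 ∧ rootSpace Γ z = Submodule.span ℂ {expMode l z v n} := by
  obtain ⟨v, hv, hMv⟩ := Matrix.exists_mulVec_eq_zero_iff.2 hs.det_eq_zero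
  exact ⟨v, hv, hΓ.rootSpace_eq_span hl hs hv hMv⟩

theorem IsDelayGraph.isSimpleEigenvalue (hΓ : IsDelayGraph D A B Γ) (hl : 0 < l) {n : ℕ}
    {z : ℂ} (hs : IsSimpleMode l D A B n z) : IsSimpleEigenvalue Γ z := by
  obtain ⟨v, hv, h⟩ := hΓ.exists_rootSpace_eq_span hl hs
  rw [IsSimpleEigenvalue, h]
  exact finrank_span_singleton (expMode_ne_zero hl z hv n)

theorem IsDelayGraph.isSpatiallyHomogeneous (hΓ : IsDelayGraph D A B Γ) (hl : 0 < l)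
    {z : ℂ} (hs : IsSimpleMode l D A B 0 z) {φ : BC l} (hφ : φ ∈ rootSpace Γ z)
    (θ : Icc (-1 : ℝ) 0) : IsSpatiallyHomogeneous (φ.1 θ) := by
  obtain ⟨v, -, h⟩ := hΓ.exists_rootSpace_eq_span hl hs
  rw [h] at hφ
  obtain ⟨a, rfl⟩ := Submodule.mem_span_singleton.1 hφ
  have e : (a • expMode l z v 0).1 θ = a • (expMode l z v 0).1 θ := rfl
  rw [e, expMode_apply, ← vecMode_smul, ← vecMode_smul]
  exact isSpatiallyHomogeneous_vecMode_zero l _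

theorem IsDelayGraph.eq_zero_of_isSpatiallyHomogeneous (hΓ : IsDelayGraph D A B Γ) (hl : 0 < l)
    {n : ℕ} (hn : n ≠ 0) {z : ℂ} (hs : IsSimpleMode l D A B n z) {φ : BC l}
    (hφ : φ ∈ rootSpace Γ z) (hφ' : ∀ θ, IsSpatiallyHomogeneous (φ.1 θ)) : φ = 0 := by
  obtain ⟨v, -, h⟩ := hΓ.exists_rootSpace_eq_span hl hs
  rw [h] at hφ
  obtain ⟨a, rfl⟩ := Submodule.mem_span_singleton.1 hφ
  refine BC.ext_modeCoord hl fun m θ => ?_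
  have e0 : modeCoord l m ((0 : BC l).1 θ) = 0 := modeCoord_zero l m
  rw [e0]
  rcases eq_or_ne m n with rfl | hm
  · exact (hφ' θ).modeCoord_eq_zero hl hn
  · have e : (a • expMode l z v n).1 θ = a • (expMode l z v n).1 θ := rfl
    rw [e, expMode_apply, modeCoord_smul, modeCoord_smul, modeCoord_vecMode_of_ne hl hm, smul_zero,
      smul_zero]

theorem IsDelayGraph.exists_det_eq_zero (hΓ : IsDelayGraph D A B Γ) (hl : 0 < l) {z : ℂ}
    (h : IsEigenvalue Γ z) : ∃ n, (charMat l D A B n z).det = 0 := by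
  by_contra! hne
  obtain ⟨φ, h0, hφ⟩ := h
  refine h0 ((Submodule.mem_bot ℂ).1 ?_)
  rw [← hΓ.rootSpace_eq_bot hl hne]
  refine Submodule.mem_iSup_of_mem 1 ⟨_, hφ, ?_⟩
  rw [sub_self]
  exact Submodule.zero_mem _

/-- The center subspace when the characteristic values on the imaginary axis are `z₁, z₂, z₃`, all
of them simple. -/
theorem IsDelayGraph.centerSpace_eq_span (hΓ : IsDelayGraph D A B Γ) (hl : 0 < l)
    {z₁ z₂ z₃ : ℂ} {n₁ n₂ n₃ : ℕ} (h₁ : IsSimpleMode l D A B n₁ z₁)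
    (h₂ : IsSimpleMode l D A B n₂ z₂) (h₃ : IsSimpleMode l D A B n₃ z₃)
    (r₁ : z₁.re = 0) (r₂ : z₂.re = 0) (r₃ : z₃.re = 0)
    (hz : ∀ n z, (charMat l D A B n z).det = 0 → z ≠ z₁ → z ≠ z₂ → z ≠ z₃ → z.re ≠ 0)
    {v₁ v₂ v₃ : Fin 2 → ℂ} (hv₁ : v₁ ≠ 0) (hv₂ : v₂ ≠ 0) (hv₃ : v₃ ≠ 0)
    (k₁ : (charMat l D A B n₁ z₁).mulVec v₁ = 0) (k₂ : (charMat l D A B n₂ z₂).mulVec v₂ = 0)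
    (k₃ : (charMat l D A B n₃ z₃).mulVec v₃ = 0) :
    centerSpace Γ =
      Submodule.span ℂ {expMode l z₁ v₁ n₁, expMode l z₂ v₂ n₂, expMode l z₃ v₃ n₃} := by
  have s₁ := hΓ.rootSpace_eq_span hl h₁ hv₁ k₁
  have s₂ := hΓ.rootSpace_eq_span hl h₂ hv₂ k₂
  have s₃ := hΓ.rootSpace_eq_span hl h₃ hv₃ k₃
  refine le_antisymm (iSup₂_le fun z hre => ?_) (Submodule.span_le.2 ?_)
  · by_cases e₁ : z = z₁
    · rw [e₁, s₁]
      exact Submodule.span_mono (by simp)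
    by_cases e₂ : z = z₂
    · rw [e₂, s₂]
      exact Submodule.span_mono (by simp)
    by_cases e₃ : z = z₃
    · rw [e₃, s₃]
      exact Submodule.span_mono (by simp)
    rw [hΓ.rootSpace_eq_bot hl fun n hn => hz n z hn e₁ e₂ e₃ hre]
    exact bot_le
  · rintro φ (rfl | rfl | rfl)
    · exact Submodule.mem_iSup_of_mem z₁ (Submodule.mem_iSup_of_mem r₁
        (s₁ ▸ Submodule.mem_span_singleton_self _))
    · exact Submodule.mem_iSup_of_mem z₂ (Submodule.mem_iSup_of_mem r₂
        (s₂ ▸ Submodule.mem_span_singleton_self _))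
    · exact Submodule.mem_iSup_of_mem z₃ (Submodule.mem_iSup_of_mem r₃
        (s₃ ▸ Submodule.mem_span_singleton_self _))

end DelayGraph

/-! ### Reflection of the dual operator -/

/-- The reflection `θ ↦ -θ` of `[-1, 0]` onto `[0, 1]`. -/
def negIcc : Icc (-1 : ℝ) 0 ≃ₜ Icc (0 : ℝ) 1 where
  toFun θ := ⟨-θ, by have := θ.2; constructor <;> linarith [this.1, this.2]⟩
  invFun s := ⟨-s, by have := s.2; constructor <;> linarith [this.1, this.2]⟩
  left_inv θ := by ext; simp
  right_inv s := by ext; simp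
  continuous_toFun := by fun_prop
  continuous_invFun := by fun_prop

theorem negIcc_zeroL : negIcc zeroL = zeroR := by ext; simp [negIcc, zeroL, zeroR]

theorem negIcc_negOneL : negIcc negOneL = oneR := by ext; simp [negIcc, negOneL, oneR]

theorem comp_mem_BCSpace {I J : Set ℝ} {c : I} {d : J} {E : Type} [NormedAddCommGroup E]
    [NormedSpace ℂ E] (e : I ≃ₜ J) (he : e c = d) {ψ : J → E} (hψ : ψ ∈ BCSpace J d E) :
    ψ ∘ e ∈ BCSpace I c E := by
  have hmaps : MapsTo e {c}ᶜ {d}ᶜ := fun x hx hx' =>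
    hx (e.injective ((show e x = d from hx').trans he.symm))
  obtain ⟨h1, x, hx⟩ := hψ
  refine ⟨h1.comp e.continuous.continuousOn hmaps, x, hx.comp ?_⟩
  have h := e.continuous.continuousAt (x := c)
  rw [ContinuousAt, he] at h
  exact tendsto_nhdsWithin_of_tendsto_nhds_of_eventually_within _
    (h.mono_left nhdsWithin_le_nhds) (eventually_nhdsWithin_of_forall hmaps)

/-- The reflection `ψ ↦ ψ(-·)` between `BC*` and `BC`. -/
def reflect (l : ℝ) : BCdual l ≃ₗ[ℂ] BC l where
  toFun ψ := ⟨ψ.1 ∘ negIcc, comp_mem_BCSpace negIcc negIcc_zeroL ψ.2⟩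
  invFun φ := ⟨φ.1 ∘ negIcc.symm,
    comp_mem_BCSpace negIcc.symm (by rw [← negIcc_zeroL, Homeomorph.symm_apply_apply]) φ.2⟩
  map_add' _ _ := rfl
  map_smul' _ _ := rfl
  left_inv ψ := Subtype.ext (funext fun s => congrArg ψ.1 (negIcc.apply_symm_apply s))
  right_inv φ := Subtype.ext (funext fun θ => congrArg φ.1 (negIcc.symm_apply_apply θ))

theorem reflect_symm_apply {l : ℝ} (φ : BC l) (θ : Icc (-1 : ℝ) 0) :
    ((reflect l).symm φ).1 (negIcc θ) = φ.1 θ := congrArg φ.1 (negIcc.symm_apply_apply θ)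

/-- Reflection changes the sign of derivatives. -/
theorem IsDerivOn.comp_neg {E : Type} [NormedAddCommGroup E] [NormedSpace ℂ E] {a b c d : ℝ}
    {hab : a ≤ b} {hcd : c ≤ d} (e : Icc a b → Icc c d) (he : ∀ θ, (e θ : ℝ) = -θ)
    {ψ ψ' : Icc c d → E} (h : IsDerivOn hcd ψ ψ') :
    IsDerivOn hab (ψ ∘ e) fun θ => -ψ' (e θ) := by
  intro θ
  have hm : MapsTo (fun t : ℝ => -t) (Icc a b) (Icc c d) := fun t ht => by
    have h1 := (e ⟨t, ht⟩).2
    rwa [he] at h1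
  have h1 := h (e θ)
  rw [he] at h1
  have h2 := h1.scomp (θ : ℝ) (hasDerivAt_neg (θ : ℝ)).hasDerivWithinAt hm
  rw [neg_one_smul] at h2
  have hc : ∀ t ∈ Icc a b, IccExtend hab (ψ ∘ e) t = (IccExtend hcd ψ ∘ fun t : ℝ => -t) t := by
    intro t ht
    rw [IccExtend_of_mem _ _ ht, Function.comp_apply, Function.comp_apply,
      IccExtend_of_mem _ _ (hm ht)]
    congr 1
    exact Subtype.ext (he ⟨t, ht⟩)
  exact h2.congr hc (hc θ θ.2)

/-- Under the reflection, the dual operator becomes the delay operator with transposed matrices. -/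
theorem isDelayGraph_reflect_dualGenerator (S : RDSystem) (μ : Fin 2 → ℝ) :
    IsDelayGraph (S.D μ) (S.A μ).transpose (S.B μ).transpose
      ((S.dualGenerator μ).comap
        ((reflect S.l).symm.toLinearMap.prodMap (reflect S.l).symm.toLinearMap)) := by
  intro p
  have v0 : ((reflect S.l).symm p.1).1 zeroR = p.1.1 zeroL :=
    (congrArg _ negIcc_zeroL.symm).trans (reflect_symm_apply p.1 zeroL)
  have v1 : ((reflect S.l).symm p.1).1 oneR = p.1.1 negOneL :=
    (congrArg _ negIcc_negOneL.symm).trans (reflect_symm_apply p.1 negOneL)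
  have hneg : ∀ θ, (negIcc θ : ℝ) = -θ := fun θ => rfl
  have hneg' : ∀ s, (negIcc.symm s : ℝ) = -s := fun s => rfl
  have hz : ∀ θ, negIcc θ = zeroR ↔ θ = zeroL := fun θ => by
    rw [← negIcc_zeroL, negIcc.injective.eq_iff]
  constructor
  · rintro ⟨ψ', z, h1, h2, h3, h4⟩
    refine ⟨fun θ => -ψ' (negIcc θ), z, (h1.comp negIcc.continuous).neg, ?_, ?_, fun θ => ?_⟩
    · have e : p.1.1 = ((reflect S.l).symm p.1).1 ∘ negIcc :=
        funext fun θ => (reflect_symm_apply p.1 θ).symm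
      rw [e]
      exact h2.comp_neg (hab := by norm_num) negIcc hneg
    · exact v0 ▸ h3
    · have h5 : ((reflect S.l).symm p.2).1 (negIcc θ) = _ := h4 (negIcc θ)
      rw [reflect_symm_apply] at h5
      rw [h5]
      simp only [hz, negIcc_zeroL, sub_neg_eq_add, ← v0, ← v1]
      rfl
  · rintro ⟨φ', z, h1, h2, h3, h4⟩
    refine ⟨fun s => -φ' (negIcc.symm s), z, (h1.comp negIcc.symm.continuous).neg,
      h2.comp_neg (hab := by norm_num) negIcc.symm hneg', ?_, fun s => ?_⟩
    · exact v0.symm ▸ h3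
    · obtain ⟨θ, rfl⟩ := negIcc.surjective s
      have h5 : ((reflect S.l).symm p.2).1 (negIcc θ) = _ := reflect_symm_apply p.2 θ
      have h6 : (((reflect S.l).symm.toLinearMap.prodMap (reflect S.l).symm.toLinearMap) p).2.1
          (negIcc θ) = ((reflect S.l).symm p.2).1 (negIcc θ) := rfl
      rw [h6, h5, h4]
      have e0 : negIcc.symm zeroR = zeroL := by rw [← negIcc_zeroL, negIcc.symm_apply_apply]
      simp only [hz, e0, neg_neg, negIcc.symm_apply_apply, ← sub_eq_add_neg, ← v0, ← v1]
      rfl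

section Transfer

variable {E F : Type} [AddCommGroup E] [Module ℂ E] [AddCommGroup F] [Module ℂ F]

/-- Root subspaces are transported by a linear conjugation. -/
theorem map_rootKer (e : E ≃ₗ[ℂ] F) (Γ : Submodule ℂ (F × F)) (z : ℂ) (k : ℕ) :
    (rootKer (Γ.comap (e.toLinearMap.prodMap e.toLinearMap)) z k).map e.toLinearMap =
      rootKer Γ z k := by
  induction k with
  | zero => exact Submodule.map_bot _
  | succ k ih =>
    ext ψ
    constructor
    · rintro ⟨φ, ⟨χ, h1, h2⟩, rfl⟩
      refine ⟨e χ, h1, ?_⟩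
      rw [← ih]
      exact ⟨_, h2, by simp⟩
    · rintro ⟨χ, h1, h2⟩
      rw [← ih] at h2
      obtain ⟨ρ, hρ, hρ'⟩ := h2
      refine ⟨e.symm ψ, ⟨e.symm χ, ?_, ?_⟩, by simp⟩
      · simpa using h1
      · have e1 : e.symm χ - z • e.symm ψ = ρ := e.injective (by simpa using hρ'.symm)
        rw [e1]
        exact hρ

theorem map_centerSpace (e : E ≃ₗ[ℂ] F) (Γ : Submodule ℂ (F × F)) :
    (centerSpace (Γ.comap (e.toLinearMap.prodMap e.toLinearMap))).map e.toLinearMap =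
      centerSpace Γ := by
  simp only [centerSpace, rootSpace, Submodule.map_iSup, map_rootKer]

end Transfer

/-! ### The characteristic equation of the system -/

theorem RDSystem.isDelayGraph_generator (S : RDSystem) (μ : Fin 2 → ℝ) :
    IsDelayGraph (S.D μ) (S.A μ) (S.B μ) (S.generator μ) := fun _ => Iff.rfl

theorem charMat_transpose (l : ℝ) {D : Matrix (Fin 2) (Fin 2) ℂ} (hD : D.transpose = D)
    (A B : Matrix (Fin 2) (Fin 2) ℂ) (n : ℕ) (z : ℂ) :
    charMat l D A.transpose B.transpose n z = (charMat l D A B n z).transpose := by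
  simp [charMat, hD]

theorem IsSimpleMode.transpose {l : ℝ} {D A B : Matrix (Fin 2) (Fin 2) ℂ} {n : ℕ} {z : ℂ}
    (hD : D.transpose = D) (h : IsSimpleMode l D A B n z) :
    IsSimpleMode l D A.transpose B.transpose n z where
  det_eq_zero := by rw [charMat_transpose l hD, Matrix.det_transpose, h.det_eq_zero]
  trace_ne_zero := by
    have e : (1 + Complex.exp (-z) • B.transpose) = (1 + Complex.exp (-z) • B).transpose := by simp
    rw [charMat_transpose l hD, ← Matrix.adjugate_transpose, e, Matrix.trace_transpose_mul]
    exact h.trace_ne_zero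
  det_ne_zero m hm := by
    rw [charMat_transpose l hD, Matrix.det_transpose]
    exact h.det_ne_zero m hm

/-- Jacobi's formula for the characteristic determinant. -/
theorem hasDerivAt_det_charMat (l : ℝ) (D A B : Matrix (Fin 2) (Fin 2) ℂ) (n : ℕ) (z : ℂ) :
    HasDerivAt (fun z => (charMat l D A B n z).det)
      ((charMat l D A B n z).adjugate * (1 + Complex.exp (-z) • B)).trace z := by
  have hexp : HasDerivAt (fun z : ℂ => Complex.exp (-z)) (-Complex.exp (-z)) z := by
    simpa using (hasDerivAt_neg z).cexp
  have hent : ∀ i j, HasDerivAt (fun z => charMat l D A B n z i j)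
      ((1 + Complex.exp (-z) • B) i j) z := by
    intro i j
    have h := (((hasDerivAt_id z).mul_const ((1 : Matrix (Fin 2) (Fin 2) ℂ) i j)).add_const
      ((n : ℂ) ^ 2 / (l : ℂ) ^ 2 * D i j - A i j)).sub (hexp.mul_const (B i j))
    refine (h.congr_of_eventuallyEq (Eventually.of_forall fun w => ?_)).congr_deriv ?_
    · simp [charMat]; ring
    · simp
  have h := ((hent 0 0).mul (hent 1 1)).sub ((hent 0 1).mul (hent 1 0))
  refine (h.congr_of_eventuallyEq (Eventually.of_forall fun w => ?_)).congr_deriv ?_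
  · exact Matrix.det_fin_two _
  · generalize charMat l D A B n z = M
    generalize (1 + Complex.exp (-z) • B) = N
    simp only [Matrix.trace, Matrix.diag, Fin.sum_univ_two, Matrix.mul_apply,
      Matrix.adjugate_fin_two, Matrix.of_apply, Matrix.cons_val_zero, Matrix.cons_val_one,
      Matrix.cons_val']
    ring

theorem RDSystem.IsSimpleCharValue.isSimpleMode {S : RDSystem} {μ : Fin 2 → ℝ} {n : ℕ} {z : ℂ}
    (h : S.IsSimpleCharValue μ n z) : IsSimpleMode S.l (S.D μ) (S.A μ) (S.B μ) n z where
  det_eq_zero := h.1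
  trace_ne_zero := by
    rw [← (hasDerivAt_det_charMat S.l (S.D μ) (S.A μ) (S.B μ) n z).deriv]
    exact h.2.1
  det_ne_zero := h.2.2

theorem RDSystem.HypH2.undergoesTuringHopf {S : RDSystem} {μ₀ : Fin 2 → ℝ} {ω₀ : ℝ} {n₂ : ℕ}
    (h : S.HypH2 μ₀ ω₀ n₂) : S.UndergoesTuringHopf μ₀ ω₀ := by
  obtain ⟨hn, hω₀, ⟨O, hO, hμO, α, ω, γ, hα, hω, hγ, hs, α0, ω0, α1, γ0, γ1⟩, hne⟩ := h
  refine ⟨hω₀, ⟨O ∩ ω ⁻¹' Ioi 0, hω.continuousOn.isOpen_inter_preimage hO isOpen_Ioi,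
    ⟨hμO, by rw [mem_preimage, ω0]; exact hω₀⟩, α, ω, γ, hα.mono inter_subset_left,
    hω.mono inter_subset_left, hγ.mono inter_subset_left, ?_, α0, ω0, α1, γ0, γ1⟩, ?_⟩
  · rintro μ ⟨hμ, hωμ⟩
    obtain ⟨s1, s2, s3⟩ := hs μ hμ
    have hΓ := S.isDelayGraph_generator μ
    have hz : ∀ z : ℂ, S.IsSimpleCharValue μ 0 z → IsSimpleEigenvalue (S.generator μ) z ∧
        ∀ φ ∈ rootSpace (S.generator μ) z, ∀ θ, IsSpatiallyHomogeneous (φ.1 θ) := fun z hz =>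
      ⟨hΓ.isSimpleEigenvalue S.l_pos hz.isSimpleMode, fun φ hφ θ =>
        hΓ.isSpatiallyHomogeneous S.l_pos hz.isSimpleMode hφ θ⟩
    refine ⟨hωμ, ?_, hΓ.isSimpleEigenvalue S.l_pos s3.isSimpleMode, fun φ hφ hφ' =>
      hΓ.eq_zero_of_isSpatiallyHomogeneous S.l_pos hn s3.isSimpleMode hφ hφ'⟩
    rintro z (rfl | rfl)
    · exact hz _ s1
    · exact hz _ s2
  · intro z hz hre
    obtain ⟨n, hn⟩ := (S.isDelayGraph_generator μ₀).exists_det_eq_zero S.l_pos hz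
    by_contra! hcon
    exact hne n z hn hcon.1 hcon.2.1 hcon.2.2 hre

/-! ### Explicit eigenvectors -/

theorem mulVec_cons_eq_zero {M : Matrix (Fin 2) (Fin 2) ℂ} (hdet : M.det = 0) (h : M 0 1 ≠ 0) :
    M.mulVec ![1, -M 0 0 / M 0 1] = 0 := by
  rw [Matrix.det_fin_two] at hdet
  funext i
  fin_cases i <;> simp [Matrix.mulVec, dotProduct, Fin.sum_univ_two]
  · field_simp
    ring
  · field_simp
    linear_combination -hdet

/-- The pairing of the left and the right null vector through `N`, which normalizes the adjoint
form, is a factor of `tr (adj(M) N)`: the adjugate of a singular matrix is a multiple of the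
product of its null vectors. -/
theorem pairing_ne_zero {M N : Matrix (Fin 2) (Fin 2) ℂ} (hdet : M.det = 0)
    (ht : (M.adjugate * N).trace ≠ 0) (h₁ : M 0 1 ≠ 0) (h₂ : M 1 0 ≠ 0) :
    ![1, -M 0 0 / M 1 0] ⬝ᵥ N.mulVec ![1, -M 0 0 / M 0 1] ≠ 0 := by
  rw [Matrix.det_fin_two] at hdet
  intro h
  refine ht ?_
  have e : (M.adjugate * N).trace =
      M 1 1 * (![1, -M 0 0 / M 1 0] ⬝ᵥ N.mulVec ![1, -M 0 0 / M 0 1]) := by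
    simp [Matrix.mulVec, dotProduct, Fin.sum_univ_two, Matrix.adjugate_fin_two, Matrix.trace,
      Matrix.vecMul]
    field_simp
    linear_combination (M 0 1 * N 1 0 + M 1 0 * N 0 1 - M 0 0 * N 1 1) * hdet
  rw [e, h, mul_zero]

/-- The characteristic matrix at the complex conjugate point, for real data. -/
theorem RDSystem.charMat_conj (S : RDSystem) (μ : Fin 2 → ℝ) (n : ℕ) (z : ℂ) :
    charMat S.l (S.D μ) (S.A μ) (S.B μ) n ((starRingEnd ℂ) z) =
      (charMat S.l (S.D μ) (S.A μ) (S.B μ) n z).map (starRingEnd ℂ) := by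
  ext i j
  have hA : (starRingEnd ℂ) (S.A μ i j) = S.A μ i j := by
    fin_cases i <;> fin_cases j <;> simp [RDSystem.A]
  have hB : (starRingEnd ℂ) (S.B μ i j) = S.B μ i j := by
    fin_cases i <;> fin_cases j <;> simp [RDSystem.B]
  have hD : (starRingEnd ℂ) (S.D μ i j) = S.D μ i j := by
    fin_cases i <;> fin_cases j <;> simp [RDSystem.D]
  have h1 : (starRingEnd ℂ) ((1 : Matrix (Fin 2) (Fin 2) ℂ) i j) =
      (1 : Matrix (Fin 2) (Fin 2) ℂ) i j := by
    fin_cases i <;> fin_cases j <;> simp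
  simp [charMat, hA, hB, hD, h1, ← Complex.exp_conj]

theorem map_conj_mulVec_eq_zero {M : Matrix (Fin 2) (Fin 2) ℂ} {v : Fin 2 → ℂ}
    (h : M.mulVec v = 0) :
    (M.map (starRingEnd ℂ)).mulVec (fun i => (starRingEnd ℂ) (v i)) = 0 := by
  funext i
  have := RingHom.map_mulVec (starRingEnd ℂ) M v i
  rw [h, Pi.zero_apply, map_zero] at this
  exact this.symm

theorem expVec_eq_expFun (w : ℝ) (c : Fin 2 → ℂ) : expVec w c = expFun (Complex.I * w) c := rfl

theorem const_eq_expFun (c : Fin 2 → ℂ) : ContinuousMap.const ℝ c = expFun 0 c := by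
  ext θ i
  simp [expFun]

theorem conjVec_expFun (z : ℂ) (c : Fin 2 → ℂ) :
    conjVec (expFun z c) = expFun ((starRingEnd ℂ) z) fun i => (starRingEnd ℂ) (c i) := by
  ext θ i
  simp [expFun, conjVec, ← Complex.exp_conj]

theorem reflect_symm_expMode (l : ℝ) (z : ℂ) (v : Fin 2 → ℂ) (n : ℕ) :
    (reflect l).symm (expMode l z v n) =
      withMode (Icc (0 : ℝ) 1) zeroR l (expFun (-z) v) n := by
  refine Subtype.ext (funext fun s => ?_)
  have e1 : ((reflect l).symm (expMode l z v n)).1 s = (expMode l z v n).1 (negIcc.symm s) := rfl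
  have e2 : (withMode (Icc (0 : ℝ) 1) zeroR l (expFun (-z) v) n).1 s =
      vecMode l n (Complex.exp (-z * (s : ℝ)) • v) := rfl
  have e3 : ((negIcc.symm s : Icc (-1 : ℝ) 0) : ℝ) = -s := rfl
  rw [e1, e2, expMode_apply, e3, vecMode_smul, Complex.ofReal_neg, mul_neg, neg_mul]

/-! ### The adjoint bilinear form on exponentials -/

/-- The form on `e^{-z s} w` and `e^{r θ} v`; only the part of `dη_n` at `θ = -1` contributes. -/
theorem RDSystem.adjForm_expFun (S : RDSystem) (μ : Fin 2 → ℝ) (n : ℕ) (z r : ℂ)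
    (w v : Fin 2 → ℂ) :
    S.adjForm μ n (expFun (-z) w) (expFun r v) =
      w ⬝ᵥ v - (∫ ξ in (0 : ℝ)..(-1), Complex.exp (-z) * Complex.exp ((r - z) * ξ)) *
        (w ⬝ᵥ (S.B μ).mulVec v) := by
  have e : ∀ i j, (∫ ξ in (0 : ℝ)..(-1), expFun (-z) w (ξ - -1) i * expFun r v ξ j) =
      (∫ ξ in (0 : ℝ)..(-1), Complex.exp (-z) * Complex.exp ((r - z) * ξ)) * (w i * v j) := by
    intro i j
    rw [← intervalIntegral.integral_mul_const]
    refine intervalIntegral.integral_congr fun ξ _ => ?_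
    have h : Complex.exp (-z * ((ξ - -1 : ℝ) : ℂ)) * Complex.exp (r * ξ) =
        Complex.exp (-z) * Complex.exp ((r - z) * ξ) := by
      rw [← Complex.exp_add, ← Complex.exp_add]
      congr 1
      push_cast
      ring
    simp only [expFun, ContinuousMap.coe_mk, Pi.smul_apply, smul_eq_mul]
    rw [← h]
    ring
  rw [RDSystem.adjForm, RDSystem.etaInt]
  simp only [e, intervalIntegral.integral_same]
  simp only [expFun, ContinuousMap.coe_mk, Pi.smul_apply, smul_eq_mul, Complex.ofReal_zero,
    mul_zero, Complex.exp_zero, one_mul, zero_add, Fin.sum_univ_two, dotProduct, Matrix.mulVec]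
  ring

/-- The form pairs the eigenfunctions of one characteristic value through the derivative of the
characteristic matrix. -/
theorem RDSystem.adjForm_expFun_self (S : RDSystem) (μ : Fin 2 → ℝ) (n : ℕ) (z : ℂ)
    (w v : Fin 2 → ℂ) :
    S.adjForm μ n (expFun (-z) w) (expFun z v) =
      w ⬝ᵥ (1 + Complex.exp (-z) • S.B μ).mulVec v := by
  rw [S.adjForm_expFun, Matrix.add_mulVec, Matrix.smul_mulVec, Matrix.one_mulVec, dotProduct_add,
    dotProduct_smul]
  simp

/-- Eigenfunctions for different characteristic values are orthogonal. -/
theorem RDSystem.adjForm_expFun_eq_zero (S : RDSystem) (μ : Fin 2 → ℝ) (n : ℕ) {z r : ℂ}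
    (hzr : z ≠ r) {w v : Fin 2 → ℂ}
    (hw : (charMat S.l (S.D μ) (S.A μ) (S.B μ) n z).transpose.mulVec w = 0)
    (hv : (charMat S.l (S.D μ) (S.A μ) (S.B μ) n r).mulVec v = 0) :
    S.adjForm μ n (expFun (-z) w) (expFun r v) = 0 := by
  have hne : r - z ≠ 0 := sub_ne_zero.2 hzr.symm
  have hJ : ∫ ξ in (0 : ℝ)..(-1), Complex.exp (-z) * Complex.exp ((r - z) * ξ) =
      (Complex.exp (-r) - Complex.exp (-z)) / (r - z) := by
    rw [intervalIntegral.integral_const_mul, integral_exp_mul_complex hne, mul_div_assoc', mul_sub,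
      ← Complex.exp_add, ← Complex.exp_add]
    congr 3 <;> push_cast <;> ring_nf
  have h1 : w ⬝ᵥ (charMat S.l (S.D μ) (S.A μ) (S.B μ) n z).mulVec v = 0 := by
    rw [Matrix.dotProduct_mulVec, ← Matrix.mulVec_transpose, hw, zero_dotProduct]
  have h2 : w ⬝ᵥ (charMat S.l (S.D μ) (S.A μ) (S.B μ) n r).mulVec v = 0 := by
    rw [hv, dotProduct_zero]
  simp only [charMat, Matrix.sub_mulVec, Matrix.add_mulVec, Matrix.smul_mulVec, Matrix.one_mulVec,
    dotProduct_sub, dotProduct_add, dotProduct_smul, smul_eq_mul] at h1 h2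
  rw [S.adjForm_expFun, hJ]
  field_simp
  linear_combination h2 - h1

end TuringHopf

end

open TuringHopf in
theorem mainTheorem2 (S : TuringHopf.RDSystem) (μ₀ : Fin 2 → ℝ) (ω₀ : ℝ) (n₂ : ℕ)
    (hH2 : S.HypH2 μ₀ ω₀ n₂) :
    S.UndergoesTuringHopf μ₀ ω₀ ∧
    (S.A μ₀ 0 1 + S.B μ₀ 0 1 * Complex.exp (-(Complex.I * ω₀)) ≠ 0 →
     S.A μ₀ 1 0 + S.B μ₀ 1 0 * Complex.exp (-(Complex.I * ω₀)) ≠ 0 →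
     S.A μ₀ 0 1 + S.B μ₀ 0 1 ≠ 0 →
     S.A μ₀ 1 0 + S.B μ₀ 1 0 ≠ 0 →
      -- the center subspace and the dual center subspace
      TuringHopf.centerSpace (S.generator μ₀) = Submodule.span ℂ
        {S.inBC (S.phi1 μ₀ ω₀) 0, S.inBC (TuringHopf.conjVec (S.phi1 μ₀ ω₀)) 0,
          S.inBC (S.phi2 μ₀ n₂) n₂} ∧
      TuringHopf.centerSpace (S.dualGenerator μ₀) = Submodule.span ℂ
        {S.inBCdual (S.psi1 μ₀ ω₀) 0, S.inBCdual (TuringHopf.conjVec (S.psi1 μ₀ ω₀)) 0,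
          S.inBCdual (S.psi2 μ₀ n₂) n₂} ∧
      -- eigenfunctions of the operator and of its dual for the eigenvalues `i ω₀` and `0`
      (S.inBC (S.phi1 μ₀ ω₀) 0, (Complex.I * ω₀) • S.inBC (S.phi1 μ₀ ω₀) 0) ∈ S.generator μ₀ ∧
      (S.inBC (S.phi2 μ₀ n₂) n₂, 0) ∈ S.generator μ₀ ∧
      (S.inBCdual (S.psi1 μ₀ ω₀) 0, (Complex.I * ω₀) • S.inBCdual (S.psi1 μ₀ ω₀) 0) ∈
        S.dualGenerator μ₀ ∧
      (S.inBCdual (S.psi2 μ₀ n₂) n₂, 0) ∈ S.dualGenerator μ₀ ∧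
      -- normalization
      S.adjForm μ₀ 0 (S.psi1 μ₀ ω₀) (S.phi1 μ₀ ω₀) = 1 ∧
      S.adjForm μ₀ 0 (S.psi1 μ₀ ω₀) (TuringHopf.conjVec (S.phi1 μ₀ ω₀)) = 0 ∧
      S.adjForm μ₀ n₂ (S.psi2 μ₀ n₂) (S.phi2 μ₀ n₂) = 1) := by
  refine ⟨hH2.undergoesTuringHopf, fun a1 a2 a3 a4 => ?_⟩
  obtain ⟨-, hω₀, ⟨O, -, hμO, α, ω, γ, -, -, -, hs, hα0, hω0, -, hγ0, -⟩, hne⟩ := hH2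
  obtain ⟨s1, s2, s3⟩ := hs μ₀ hμO
  rw [hα0, hω0] at s1 s2
  rw [hγ0] at s3
  set z : ℂ := Complex.I * ω₀ with hz
  have hconj : (starRingEnd ℂ) z = -z := by simp [hz]
  have hz0 : z ≠ 0 := mul_ne_zero Complex.I_ne_zero (Complex.ofReal_ne_zero.2 hω₀.ne')
  rw [show ((0 : ℝ) : ℂ) + ω₀ * Complex.I = z by rw [hz]; push_cast; ring] at s1
  rw [show ((0 : ℝ) : ℂ) - ω₀ * Complex.I = -z by rw [hz]; push_cast; ring] at s2
  rw [Complex.ofReal_zero] at s3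
  have m1 := s1.isSimpleMode
  have m2 := s2.isSimpleMode
  have m3 := s3.isSimpleMode
  have hcenter : ∀ n r, (charMat S.l (S.D μ₀) (S.A μ₀) (S.B μ₀) n r).det = 0 →
      r ≠ z → r ≠ -z → r ≠ 0 → r.re ≠ 0 := fun n r h h1 h2 h3 =>
    hne n r h (by rwa [mul_comm]) (by rwa [mul_comm]) h3
  have hD : (S.D μ₀).transpose = S.D μ₀ := Matrix.diagonal_transpose _
  have hDod : S.D μ₀ 0 1 = 0 ∧ S.D μ₀ 1 0 = 0 := by simp [RDSystem.D]
  have hexp : Complex.exp (-z) = RDSystem.expNeg ω₀ := rfl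
  -- entries of the two critical characteristic matrices
  set M := charMat S.l (S.D μ₀) (S.A μ₀) (S.B μ₀) 0 z with hM
  set M' := charMat S.l (S.D μ₀) (S.A μ₀) (S.B μ₀) n₂ 0 with hM'
  have M00 : M 0 0 = z - S.A μ₀ 0 0 - S.B μ₀ 0 0 * RDSystem.expNeg ω₀ := by
    simp [hM, charMat, hexp, mul_comm]
  have M01 : M 0 1 = -(S.A μ₀ 0 1 + S.B μ₀ 0 1 * RDSystem.expNeg ω₀) := by
    simp [hM, charMat, hexp]; ring
  have M10 : M 1 0 = -(S.A μ₀ 1 0 + S.B μ₀ 1 0 * RDSystem.expNeg ω₀) := by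
    simp [hM, charMat, hexp]; ring
  have M'00 : M' 0 0 = S.d 0 μ₀ * ((n₂ : ℂ) ^ 2 / (S.l : ℂ) ^ 2) - S.A μ₀ 0 0 - S.B μ₀ 0 0 := by
    simp [hM', charMat, RDSystem.D, mul_comm]
  have M'01 : M' 0 1 = -(S.A μ₀ 0 1 + S.B μ₀ 0 1) := by
    simp [hM', charMat, hDod.1]; ring
  have M'10 : M' 1 0 = -(S.A μ₀ 1 0 + S.B μ₀ 1 0) := by
    simp [hM', charMat, hDod.2]; ring
  have K1 : S.k1 μ₀ ω₀ = -M 0 0 / M 0 1 := by rw [M00, M01, neg_div_neg_eq]; rfl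
  have K2 : S.k2 μ₀ ω₀ = -M 0 0 / M 1 0 := by rw [M00, M10, neg_div_neg_eq]; rfl
  have K3 : S.k3 μ₀ n₂ = -M' 0 0 / M' 0 1 := by rw [M'00, M'01, neg_div_neg_eq]; rfl
  have K4 : S.k4 μ₀ n₂ = -M' 0 0 / M' 1 0 := by rw [M'00, M'10, neg_div_neg_eq]; rfl
  have b1 : M 0 1 ≠ 0 := by rw [M01]; exact neg_ne_zero.2 a1
  have b2 : M 1 0 ≠ 0 := by rw [M10]; exact neg_ne_zero.2 a2
  have b3 : M' 0 1 ≠ 0 := by rw [M'01]; exact neg_ne_zero.2 a3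
  have b4 : M' 1 0 ≠ 0 := by rw [M'10]; exact neg_ne_zero.2 a4
  -- right and left null vectors
  set v : Fin 2 → ℂ := ![1, S.k1 μ₀ ω₀] with hv
  set w : Fin 2 → ℂ := ![1, S.k2 μ₀ ω₀] with hw
  set v' : Fin 2 → ℂ := ![1, S.k3 μ₀ n₂] with hv'
  set w' : Fin 2 → ℂ := ![1, S.k4 μ₀ n₂] with hw'
  have hMv : M.mulVec v = 0 := by
    rw [hv, K1]
    exact mulVec_cons_eq_zero m1.det_eq_zero b1
  have hMw : M.transpose.mulVec w = 0 := by
    rw [hw, K2]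
    exact mulVec_cons_eq_zero (M := M.transpose) (by rw [Matrix.det_transpose, m1.det_eq_zero]) b2
  have hMv' : M'.mulVec v' = 0 := by
    rw [hv', K3]
    exact mulVec_cons_eq_zero m3.det_eq_zero b3
  have hMw' : M'.transpose.mulVec w' = 0 := by
    rw [hw', K4]
    exact mulVec_cons_eq_zero (M := M'.transpose) (by rw [Matrix.det_transpose, m3.det_eq_zero]) b4
  have p1 : w ⬝ᵥ (1 + Complex.exp (-z) • S.B μ₀).mulVec v ≠ 0 := by
    rw [hw, hv, K1, K2]
    exact pairing_ne_zero m1.det_eq_zero m1.trace_ne_zero b1 b2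
  have p3 : w' ⬝ᵥ (1 + Complex.exp (-0) • S.B μ₀).mulVec v' ≠ 0 := by
    rw [hw', hv', K3, K4]
    exact pairing_ne_zero m3.det_eq_zero m3.trace_ne_zero b3 b4
  have T1e : S.T1 μ₀ ω₀ = (w ⬝ᵥ (1 + Complex.exp (-z) • S.B μ₀).mulVec v)⁻¹ := by
    rw [RDSystem.T1, hexp]
    congr 1
    simp [hw, hv, Matrix.mulVec, dotProduct, Fin.sum_univ_two]
    ring
  have T2e : S.T2 μ₀ n₂ = (w' ⬝ᵥ (1 + Complex.exp (-0) • S.B μ₀).mulVec v')⁻¹ := by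
    rw [RDSystem.T2]
    congr 1
    simp [hw', hv', Matrix.mulVec, dotProduct, Fin.sum_univ_two]
    ring
  have hT1 : S.T1 μ₀ ω₀ ≠ 0 := by rw [T1e]; exact inv_ne_zero p1
  have hT2 : S.T2 μ₀ n₂ ≠ 0 := by rw [T2e]; exact inv_ne_zero p3
  have hMTw : M.transpose.mulVec (S.T1 μ₀ ω₀ • w) = 0 := by
    rw [Matrix.mulVec_smul, hMw, smul_zero]
  have hMTw' : M'.transpose.mulVec (S.T2 μ₀ n₂ • w') = 0 := by
    rw [Matrix.mulVec_smul, hMw', smul_zero]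
  have hMc : charMat S.l (S.D μ₀) (S.A μ₀) (S.B μ₀) 0 (-z) = M.map (starRingEnd ℂ) := by
    rw [← hconj]
    exact S.charMat_conj μ₀ 0 z
  have hvc := map_conj_mulVec_eq_zero hMv
  have hwc := map_conj_mulVec_eq_zero hMTw
  rw [← hMc] at hvc
  rw [Matrix.transpose_map, ← hMc, ← charMat_transpose _ hD] at hwc
  have hMTw₁ := hMTw
  have hMTw₂ := hMTw'
  rw [hM, ← charMat_transpose _ hD] at hMTw₁
  rw [hM', ← charMat_transpose _ hD] at hMTw₂
  -- the functions of the statement as exponentials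
  have F1 : S.phi1 μ₀ ω₀ = expFun z v := rfl
  have F1c : conjVec (S.phi1 μ₀ ω₀) = expFun (-z) fun i => (starRingEnd ℂ) (v i) := by
    rw [F1, conjVec_expFun, hconj]
  have F2 : S.phi2 μ₀ n₂ = expFun 0 v' := const_eq_expFun _
  have G1 : S.psi1 μ₀ ω₀ = expFun (-z) (S.T1 μ₀ ω₀ • w) := by
    rw [RDSystem.psi1, expVec_eq_expFun, hz, Complex.ofReal_neg, mul_neg]
  have G1c : conjVec (S.psi1 μ₀ ω₀) =
      expFun (- -z) fun i => (starRingEnd ℂ) ((S.T1 μ₀ ω₀ • w) i) := by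
    rw [G1, conjVec_expFun, map_neg, hconj]
  have G2 : S.psi2 μ₀ n₂ = expFun (-0) (S.T2 μ₀ n₂ • w') := by
    rw [neg_zero]
    exact const_eq_expFun _
  have ne1 : ∀ k : ℂ, (![1, k] : Fin 2 → ℂ) ≠ 0 := fun k h => one_ne_zero (congrFun h 0)
  have nec : ∀ u : Fin 2 → ℂ, u ≠ 0 → (fun i => (starRingEnd ℂ) (u i)) ≠ 0 := fun u hu h =>
    hu (funext fun i => (map_eq_zero (starRingEnd ℂ)).1 (congrFun h i))
  have hΓ := S.isDelayGraph_generator μ₀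
  have hΓ' := isDelayGraph_reflect_dualGenerator S μ₀
  have rz : z.re = 0 := by simp [hz]
  have rz' : (-z).re = 0 := by simp [hz]
  have D1 : S.inBCdual (S.psi1 μ₀ ω₀) 0 =
      (reflect S.l).symm (expMode S.l z (S.T1 μ₀ ω₀ • w) 0) := by
    rw [reflect_symm_expMode, G1]; rfl
  have D1c : S.inBCdual (conjVec (S.psi1 μ₀ ω₀)) 0 = (reflect S.l).symm
      (expMode S.l (-z) (fun i => (starRingEnd ℂ) ((S.T1 μ₀ ω₀ • w) i)) 0) := by
    rw [reflect_symm_expMode, G1c]; rfl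
  have D2 : S.inBCdual (S.psi2 μ₀ n₂) n₂ =
      (reflect S.l).symm (expMode S.l 0 (S.T2 μ₀ n₂ • w') n₂) := by
    rw [reflect_symm_expMode, G2]; rfl
  refine ⟨?_, ?_, ?_, ?_, ?_, ?_, ?_, ?_, ?_⟩
  · rw [F1c, F1, F2]
    exact hΓ.centerSpace_eq_span S.l_pos m1 m2 m3 rz rz' Complex.zero_re hcenter (ne1 _)
      (nec _ (ne1 _)) (ne1 _) hMv hvc hMv'
  · have hcenter' : ∀ n r,
        (charMat S.l (S.D μ₀) (S.A μ₀).transpose (S.B μ₀).transpose n r).det = 0 →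
        r ≠ z → r ≠ -z → r ≠ 0 → r.re ≠ 0 := fun n r h => by
      rw [charMat_transpose _ hD, Matrix.det_transpose] at h
      exact hcenter n r h
    have h := hΓ'.centerSpace_eq_span S.l_pos (m1.transpose hD) (m2.transpose hD)
      (m3.transpose hD) rz rz' Complex.zero_re hcenter' (smul_ne_zero hT1 (ne1 _))
      (nec _ (smul_ne_zero hT1 (ne1 _))) (smul_ne_zero hT2 (ne1 _)) hMTw₁ hwc hMTw₂
    rw [← map_centerSpace (reflect S.l).symm, h, Submodule.map_span, image_insert_eq,
      image_insert_eq, image_singleton, D1, D1c, D2]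
    rfl
  · exact hΓ.expMode_mem hMv
  · have h := hΓ.expMode_mem hMv'
    rw [zero_smul] at h
    rw [F2]
    exact h
  · rw [D1, ← map_smul]
    exact hΓ'.expMode_mem hMTw₁
  · have h := hΓ'.expMode_mem hMTw₂
    rw [zero_smul] at h
    rw [D2, ← map_zero (reflect S.l).symm]
    exact h
  · rw [G1, F1, S.adjForm_expFun_self, smul_dotProduct, T1e, smul_eq_mul, inv_mul_cancel₀ p1]
  · rw [G1, F1c]
    exact S.adjForm_expFun_eq_zero μ₀ 0 (self_ne_neg.2 hz0) hMTw hvc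
  · rw [G2, F2, S.adjForm_expFun_self, smul_dotProduct, T2e, smul_eq_mul, inv_mul_cancel₀ p3]
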